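/- Let $K$ and $L$ be number fields, with adele rings $\mathbb{A}_K$ and $\mathbb{A}_L$. Suppose that $\mathbb{A}_K$ and $\mathbb{A}_L$ are elementarily equivalent as rings, i.e. they satisfy the same first-order sentences in the language of rings. Then $\mathbb{A}_K$ and $\mathbb{A}_L$ are isomorphic as topological rings: there is a ring isomorphism $\mathbb{A}_K \to \mathbb{A}_L$ that is also a homeomorphism for the adelic (restricted product) topologies. In particular, they are isomorphic as rings. -/

import Mathlib

open scoped NumberField

/-- Two commutative rings are elementarily equivalent when they satisfy the same first-order
sentences of the language of rings `(+, *, -, 0, 1)`, each ring being regarded as a structure for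
that language through its own operations. -/
def RingElementarilyEquivalent (R S : Type*) [CommRing R] [CommRing S] : Prop :=
  letI := FirstOrder.Ring.compatibleRingOfRing R
  letI := FirstOrder.Ring.compatibleRingOfRing S
  FirstOrder.Language.ring.ElementarilyEquivalent R S

/-!
Elementarily equivalent adele rings of number fields are shown to be isomorphic by recovering the
family of completions, with multiplicities, from first-order sentences.

The adele ring is a subring of the product of all completions, and its minimal idempotents
correspond to the places (`IsSubdirectProduct.exists_eq_of_isMinimalIdempotent`). If `e` belongs to
the place `v`, then an equation holds in the completion at `v` if and only if it holds in the adele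
ring after multiplication by `e`. Hence every first-order property of a field gives a formula for
idempotents, and elementarily equivalent adele rings have equally many places whose completions have
this property (`RingElementarilyEquivalent.encard_definedSet_eq`).

Complex and real places are recognized by their squares. To recognize the finite places above a
prime number `p`, choose an odd prime `l ≠ p` larger than the valuations of `p`. At these places, the
set of all `x` for which `1 + p * x ^ l` is an `l`-th power is the ring of integers: units congruent
to `1` are `l`-th powers, and if `x` is not integral, then the valuation of `1 + p * x ^ l` is not
divisible by `l`. In particular this set contains `p`, is closed under multiplication,
and does not contain the inverse of `p`. At all other places these three properties cannot hold
together (`ResidueCharProperty`, `encard_definedSet_rootFormula`).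

To tell the finitely many completions above `p` apart, existence of roots of integral polynomials
suffices. For a place `v` above `p`, take an integral generator `θ` of the number field that is
congruent to `1` modulo `v` and to `p` modulo `p ^ 2` at the other places above `p`, and let `g` be
the polynomial of the `l`-th roots of the conjugates of `θ`. It has a root in the completion at `v`.
Conversely, a root of `g` in the completion at a place `w` of any number field gives an embedding of
the number field which makes `θ` an `l`-th power, and this forces `w` to restrict to `v`, so that the
completion at `v` embeds into the one at `w` (`IsSeparatingGenerator.rootPolynomial_mem_iff`).
Consequently, for each `v`, the number of completions above `p` into which the one at `v` embeds is
the same for both number fields. A count from the top (`exists_equiv_of_card_le_eq`) matches the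
places so that matched completions embed into each other, and such completions are isomorphic,
because a local field has no proper integral self-embeddings (`IsIntegralHom.surjective`). The local
isomorphisms respect the topologies and the rings of integers, and therefore glue to an isomorphism
of topological rings.
-/

/-! ### First-order formulas over rings -/

open FirstOrder FirstOrder.Language FirstOrder.Ring in
/-- The formula `p = 0`, for a polynomial expression `p` in the variables. -/
noncomputable def ringEqZero (p : FreeCommRing ℕ) : Language.ring.Formula ℕ :=
  (termOfFreeCommRing p).equal 0

/-- The formula `∃ xₖ, φ`, where quantification is over a named variable. -/
noncomputable def ringEx (k : ℕ) (φ : FirstOrder.Language.ring.Formula ℕ) :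
    FirstOrder.Language.ring.Formula ℕ :=
  FirstOrder.Language.Formula.iExs Unit
    (φ.relabel fun i => if i = k then Sum.inr () else Sum.inl i)

/-- The formula `∀ xₖ, φ`, where quantification is over a named variable. -/
noncomputable def ringAll (k : ℕ) (φ : FirstOrder.Language.ring.Formula ℕ) :
    FirstOrder.Language.ring.Formula ℕ :=
  FirstOrder.Language.Formula.iAlls Unit
    (φ.relabel fun i => if i = k then Sum.inr () else Sum.inl i)

theorem elim_comp_ite_eq_update {R : Type*} (v : ℕ → R) (k : ℕ) (x : Unit → R) :
    (Sum.elim v x ∘ fun i => if i = k then Sum.inr () else Sum.inl i) =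
      Function.update v k (x ()) := by
  ext i
  by_cases h : i = k
  · subst h; simp
  · simp [h]

section Realize

variable {R : Type*} [CommRing R] [FirstOrder.Ring.CompatibleRing R]

@[simp]
theorem realize_ringEqZero (p : FreeCommRing ℕ) (v : ℕ → R) :
    (ringEqZero p).Realize v ↔ FreeCommRing.lift v p = 0 := by
  simp [ringEqZero]

@[simp]
theorem realize_ringEx (k : ℕ) (φ : FirstOrder.Language.ring.Formula ℕ) (v : ℕ → R) :
    (ringEx k φ).Realize v ↔ ∃ x, φ.Realize (Function.update v k x) := by
  simp only [ringEx, FirstOrder.Language.Formula.realize_iExs,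
    FirstOrder.Language.Formula.realize_relabel, elim_comp_ite_eq_update]
  exact ⟨fun ⟨x, hx⟩ => ⟨_, hx⟩, fun ⟨x, hx⟩ => ⟨fun _ => x, hx⟩⟩

@[simp]
theorem realize_ringAll (k : ℕ) (φ : FirstOrder.Language.ring.Formula ℕ) (v : ℕ → R) :
    (ringAll k φ).Realize v ↔ ∀ x, φ.Realize (Function.update v k x) := by
  simp only [ringAll, FirstOrder.Language.Formula.realize_iAlls,
    FirstOrder.Language.Formula.realize_relabel]
  exact ⟨fun h x => elim_comp_ite_eq_update v k (fun _ => x) ▸ h fun _ => x,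
    fun h x => (elim_comp_ite_eq_update v k x).symm ▸ h (x ())⟩

end Realize

/-- The elements of a commutative ring which satisfy a first-order formula, all of whose free
variables are given the same value. -/
def definedSet (R : Type*) [CommRing R] (φ : FirstOrder.Language.ring.Formula ℕ) : Set R :=
  letI := FirstOrder.Ring.compatibleRingOfRing R
  {e | φ.Realize fun _ => e}

/-- The sentence saying that at least `m` elements satisfy `φ`. -/
noncomputable def atLeastSentence (m : ℕ) (φ : FirstOrder.Language.ring.Formula ℕ) :
    FirstOrder.Language.ring.Sentence :=
  FirstOrder.Language.Formula.iExs (Fin m)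
    ((FirstOrder.Language.Formula.iInf fun i : Fin m =>
        (φ.relabel fun _ => Sum.inr i : FirstOrder.Language.ring.Formula (Empty ⊕ Fin m))) ⊓
      FirstOrder.Language.Formula.iInf fun q : {q : Fin m × Fin m // q.1 ≠ q.2} =>
        ((FirstOrder.Language.Term.var (Sum.inr q.1.1)).equal
          (FirstOrder.Language.Term.var (Sum.inr q.1.2)) :
            FirstOrder.Language.ring.Formula (Empty ⊕ Fin m)).not)

theorem realize_atLeastSentence {R : Type*} [CommRing R] (m : ℕ)
    (φ : FirstOrder.Language.ring.Formula ℕ) :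
    letI := FirstOrder.Ring.compatibleRingOfRing R
    FirstOrder.Language.Sentence.Realize R (atLeastSentence m φ) ↔
      (m : ℕ∞) ≤ (definedSet R φ).encard := by
  let _ := FirstOrder.Ring.compatibleRingOfRing R
  have h : FirstOrder.Language.Sentence.Realize R (atLeastSentence m φ) ↔
      ∃ x : Fin m → R, (∀ i, x i ∈ definedSet R φ) ∧ Function.Injective x := by
    rw [FirstOrder.Language.Sentence.Realize, atLeastSentence,
      FirstOrder.Language.Formula.realize_iExs]
    refine exists_congr fun x => ?_
    rw [FirstOrder.Language.Formula.realize_inf]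
    refine and_congr ?_ ?_
    · simp only [FirstOrder.Language.Formula.realize_iInf, definedSet,
        FirstOrder.Language.Formula.realize_relabel]
      rfl
    · simp only [FirstOrder.Language.Formula.realize_iInf,
        FirstOrder.Language.Formula.realize_not, FirstOrder.Language.Formula.realize_equal]
      exact ⟨fun h i j hij => by_contra fun hne => h ⟨(i, j), hne⟩ hij,
        fun h q hq => q.2 (h hq)⟩
  rw [h]
  constructor
  · rintro ⟨x, hx, hinj⟩
    calc (m : ℕ∞) = (Set.range x).encard := by
          rw [← Set.image_univ, hinj.encard_image]; simp
      _ ≤ _ := Set.encard_le_encard (by rintro _ ⟨i, rfl⟩; exact hx i)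
  · intro hm
    obtain ⟨t, ht, htm⟩ := Set.exists_subset_encard_eq hm
    have hfin : t.Finite := Set.finite_of_encard_eq_coe htm
    have hc : Nat.card t = m := by
      rw [Nat.card_coe_set_eq, Set.ncard, htm]; rfl
    have := hfin.to_subtype
    let e := (Finite.equivFinOfCardEq hc).symm
    exact ⟨fun i => e i, fun i => ht (e i).2, Subtype.val_injective.comp e.injective⟩

/-- Elementarily equivalent rings have equally many elements satisfying a given formula (both
numbers being infinite if one of them is). -/
theorem RingElementarilyEquivalent.encard_definedSet_eq {R S : Type*} [CommRing R] [CommRing S]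
    (h : RingElementarilyEquivalent R S) (φ : FirstOrder.Language.ring.Formula ℕ) :
    (definedSet R φ).encard = (definedSet S φ).encard := by
  have key : ∀ m : ℕ, (m : ℕ∞) ≤ (definedSet R φ).encard ↔
      (m : ℕ∞) ≤ (definedSet S φ).encard := fun m => by
    rw [← realize_atLeastSentence, ← realize_atLeastSentence]
    let _ := FirstOrder.Ring.compatibleRingOfRing R
    let _ := FirstOrder.Ring.compatibleRingOfRing S
    exact FirstOrder.Language.elementarilyEquivalent_iff.1 h _
  exact ENat.eq_of_forall_natCast_le_iff key

/-! ### Formulas describing one component of a product of fields -/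

/-- A minimal nonzero idempotent. -/
def IsMinimalIdempotent {A : Type*} [CommRing A] (e : A) : Prop :=
  e * e = e ∧ e ≠ 0 ∧ ∀ f : A, f * f = f → e * f = 0 ∨ e * f = e

/-- The element `e` of `A` cuts out the component `π : A → F`: the map `π` is onto, and its kernel
is the annihilator of `e`. -/
structure IsComponent {A F : Type*} [CommRing A] [Field F] (e : A) (π : A →+* F) : Prop where
  surjective : Function.Surjective π
  mul_eq_zero_iff : ∀ a, e * a = 0 ↔ π a = 0

/-- The formula "`x₀` is a minimal idempotent". -/
noncomputable def minimalIdempotentFormula : FirstOrder.Language.ring.Formula ℕ :=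
  open FreeCommRing in
  ringEqZero (of 0 * of 0 - of 0) ⊓ (ringEqZero (of 0)).not ⊓
    ringAll 1 ((ringEqZero (of 1 * of 1 - of 1)).imp
      (ringEqZero (of 0 * of 1) ⊔ ringEqZero (of 0 * of 1 - of 0)))

/-- In a field `F`, let `S = {x | 1 + p * x ^ l is an l-th power}`. The property says that `p ∈ S`,
that `S` is closed under multiplication, and that `p` has no inverse in `S`. For a suitable
exponent `l`, among the completions of a number field, it singles out those at the primes
above `p`. -/
def ResidueCharProperty (F : Type*) [Field F] (p l : ℕ) : Prop :=
  (∃ y : F, 1 + p * (p : F) ^ l - y ^ l = 0) ∧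
  (∀ x x' y y' : F, 1 + p * x ^ l - y ^ l = 0 → 1 + p * x' ^ l - y' ^ l = 0 →
    ∃ z : F, 1 + p * (x * x') ^ l - z ^ l = 0) ∧
  ∀ x y : F, p * x - 1 = 0 → ¬ 1 + p * x ^ l - y ^ l = 0

/-- The formula "`x₀` is a minimal idempotent, whose component satisfies `ResidueCharProperty` and
contains a root of the polynomial `g`". -/
noncomputable def rootFormula (p l : ℕ) (g : Polynomial ℤ) : FirstOrder.Language.ring.Formula ℕ :=
  open FreeCommRing in
  let P : FreeCommRing ℕ := p
  minimalIdempotentFormula ⊓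
    (ringEx 3 (ringEqZero (of 0 * (1 + P * P ^ l - of 3 ^ l))) ⊓
    ringAll 1 (ringAll 2 (ringAll 3 (ringAll 4
      ((ringEqZero (of 0 * (1 + P * of 1 ^ l - of 3 ^ l))).imp
        ((ringEqZero (of 0 * (1 + P * of 2 ^ l - of 4 ^ l))).imp
          (ringEx 5 (ringEqZero (of 0 * (1 + P * (of 1 * of 2) ^ l - of 5 ^ l))))))))) ⊓
    ringAll 1 (ringAll 3 ((ringEqZero (of 0 * (P * of 1 - 1))).imp
      (ringEqZero (of 0 * (1 + P * of 1 ^ l - of 3 ^ l))).not)) ⊓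
    ringEx 1 (ringEqZero (of 0 * Polynomial.aeval (of 1) g)))

/-- The formula "`x₀` is a minimal idempotent, in whose component every element is a square". -/
noncomputable def complexFormula : FirstOrder.Language.ring.Formula ℕ :=
  open FreeCommRing in
  minimalIdempotentFormula ⊓ ringAll 1 (ringEx 2 (ringEqZero (of 0 * (of 1 - of 2 ^ 2))))

/-- The formula "`x₀` is a minimal idempotent, in whose component every element is a square up to
sign, but not every element is a square". -/
noncomputable def realFormula : FirstOrder.Language.ring.Formula ℕ :=
  open FreeCommRing in
  minimalIdempotentFormula ⊓
    (ringAll 1 (ringEx 2 (ringEqZero (of 0 * (of 1 - of 2 ^ 2)) ⊔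
      ringEqZero (of 0 * (of 1 + of 2 ^ 2)))) ⊓
    (ringAll 1 (ringEx 2 (ringEqZero (of 0 * (of 1 - of 2 ^ 2))))).not)

section

variable {A F : Type*} [CommRing A] [Field F] {e : A} {π : A →+* F}

theorem realize_minimalIdempotentFormula [FirstOrder.Ring.CompatibleRing A] (e : A) :
    minimalIdempotentFormula.Realize (fun _ => e) ↔ IsMinimalIdempotent e := by
  simp [minimalIdempotentFormula, IsMinimalIdempotent, sub_eq_zero, and_assoc]

theorem mem_definedSet_rootFormula (hπ : IsComponent e π) (p l : ℕ) (g : Polynomial ℤ) :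
    e ∈ definedSet A (rootFormula p l g) ↔ IsMinimalIdempotent e ∧ ResidueCharProperty F p l ∧
      ∃ y : F, g.eval₂ (Int.castRingHom F) y = 0 := by
  let _ := FirstOrder.Ring.compatibleRingOfRing A
  have hg (v : ℕ → A) (i : ℕ) : FreeCommRing.lift v (Polynomial.aeval (FreeCommRing.of i) g) =
      g.eval₂ (Int.castRingHom A) (v i) := by
    rw [Polynomial.aeval_def, Polynomial.hom_eval₂, FreeCommRing.lift_of]
    congr 1
    exact RingHom.ext_int _ _
  have hg' (y : A) : π (g.eval₂ (Int.castRingHom A) y) = g.eval₂ (Int.castRingHom F) (π y) := by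
    rw [Polynomial.hom_eval₂]
    congr 1
    exact RingHom.ext_int _ _
  simp only [definedSet, Set.mem_ofPred_eq, rootFormula, FirstOrder.Language.Formula.realize_inf,
    realize_minimalIdempotentFormula, realize_ringEx, realize_ringAll, realize_ringEqZero,
    FirstOrder.Language.Formula.realize_imp, FirstOrder.Language.Formula.realize_not]
  simp [hπ.mul_eq_zero_iff, hg, hg', ResidueCharProperty, hπ.surjective.exists, hπ.surjective.forall,
    and_assoc]

theorem mem_definedSet_complexFormula (hπ : IsComponent e π) :
    e ∈ definedSet A complexFormula ↔ IsMinimalIdempotent e ∧ ∀ x : F, ∃ y : F, x = y ^ 2 := by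
  let _ := FirstOrder.Ring.compatibleRingOfRing A
  simp only [definedSet, Set.mem_ofPred_eq, complexFormula, FirstOrder.Language.Formula.realize_inf,
    realize_minimalIdempotentFormula, realize_ringEx, realize_ringAll, realize_ringEqZero]
  simp [hπ.mul_eq_zero_iff, hπ.surjective.exists, hπ.surjective.forall, sub_eq_zero]

theorem mem_definedSet_realFormula (hπ : IsComponent e π) :
    e ∈ definedSet A realFormula ↔ IsMinimalIdempotent e ∧
      (∀ x : F, ∃ y : F, x = y ^ 2 ∨ x = - y ^ 2) ∧ ¬ ∀ x : F, ∃ y : F, x = y ^ 2 := by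
  let _ := FirstOrder.Ring.compatibleRingOfRing A
  simp only [definedSet, Set.mem_ofPred_eq, realFormula, FirstOrder.Language.Formula.realize_inf,
    FirstOrder.Language.Formula.realize_sup, FirstOrder.Language.Formula.realize_not,
    realize_minimalIdempotentFormula, realize_ringEx, realize_ringAll, realize_ringEqZero]
  simp [hπ.mul_eq_zero_iff, hπ.surjective.exists, hπ.surjective.forall, sub_eq_zero,
    add_eq_zero_iff_eq_neg]

theorem isMinimalIdempotent_of_mem_definedSet {φ : FirstOrder.Language.ring.Formula ℕ}
    (h : e ∈ definedSet A (minimalIdempotentFormula ⊓ φ)) : IsMinimalIdempotent e := by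
  let _ := FirstOrder.Ring.compatibleRingOfRing A
  rw [definedSet, Set.mem_ofPred_eq, FirstOrder.Language.Formula.realize_inf,
    realize_minimalIdempotentFormula] at h
  exact h.1

end

/-! ### Completions at finite places: topology, compactness, and roots of units -/

open IsDedekindDomain HeightOneSpectrum Filter Topology WithZero

section LocalField

variable {K : Type*} [Field K] [NumberField K] {v : HeightOneSpectrum (𝓞 K)}

theorem mem_nhds_zero_iff_exists_valued_lt {s : Set (v.adicCompletion K)} :
    s ∈ 𝓝 0 ↔ ∃ a : v.adicCompletion K, a ≠ 0 ∧ {x | Valued.v x < Valued.v a} ⊆ s := by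
  rw [Valued.mem_nhds_zero]
  constructor
  · rintro ⟨γ, hγ⟩
    obtain ⟨a, ha⟩ := valuedAdicCompletion_surjective K v
      (MonoidWithZeroHom.ValueGroup₀.embedding γ.1)
    refine ⟨a, ?_, fun x hx => hγ ?_⟩
    · rintro rfl
      rw [map_zero, eq_comm, map_eq_zero] at ha
      exact γ.ne_zero ha
    · rw [Set.mem_ofPred_eq, Valuation.restrict_lt_iff_lt_embedding, ← ha]
      exact hx
  · rintro ⟨a, ha, hs⟩
    refine ⟨Units.mk0 (Valued.v.restrict a) (by simpa using ha), fun x hx => hs ?_⟩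
    simpa [Valuation.restrict_lt_iff] using hx

theorem setOf_valued_sub_lt_mem_nhds {a : v.adicCompletion K} (ha : a ≠ 0)
    (x : v.adicCompletion K) : {y | Valued.v (y - x) < Valued.v a} ∈ 𝓝 x := by
  have h : {y | Valued.v y < Valued.v a} ∈ 𝓝 (x - x) := by
    rw [sub_self]
    exact mem_nhds_zero_iff_exists_valued_lt.2 ⟨a, ha, subset_rfl⟩
  exact (continuous_id.sub continuous_const).continuousAt h

theorem valued_algebraMap_ringOfIntegers_le_one (a : 𝓞 K) :
    Valued.v (algebraMap K (v.adicCompletion K) (a : K)) ≤ 1 :=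
  coe_mem_adicCompletionIntegers v a

theorem valued_algebraMap_ringOfIntegers_lt_one_iff (a : 𝓞 K) :
    Valued.v (algebraMap K (v.adicCompletion K) (a : K)) < 1 ↔ a ∈ v.asIdeal := by
  rw [← valuation_lt_one_iff_mem (K := K)]
  exact (valuedAdicCompletion_eq_valuation' v (a : K)).symm ▸ Iff.rfl

theorem valued_natCast_le_one (n : ℕ) : Valued.v (n : v.adicCompletion K) ≤ 1 := by
  simpa using valued_algebraMap_ringOfIntegers_le_one (v := v) (n : 𝓞 K)

theorem valued_natCast_lt_one_iff (n : ℕ) :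
    Valued.v (n : v.adicCompletion K) < 1 ↔ (n : 𝓞 K) ∈ v.asIdeal := by
  simpa using valued_algebraMap_ringOfIntegers_lt_one_iff (v := v) (n : 𝓞 K)

theorem exists_ringOfIntegers_valued_sub_lt_one (x : v.adicCompletion K) (hx : Valued.v x ≤ 1) :
    ∃ a : 𝓞 K, Valued.v (algebraMap K _ (a : K) - x) < 1 := by
  obtain ⟨k, hk⟩ := (denseRange_algebraMap (R := 𝓞 K) K v).exists_mem_open
    isOpen_interior ⟨x, mem_interior_iff_mem_nhds.2 (setOf_valued_sub_lt_mem_nhds one_ne_zero x)⟩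
  replace hk : Valued.v (algebraMap K _ k - x) < 1 := by simpa using interior_subset hk
  have hk1 : v.valuation K k ≤ 1 := by
    rw [← valuedAdicCompletion_eq_valuation']
    change Valued.v (algebraMap K (v.adicCompletion K) k) ≤ 1
    rw [show algebraMap K (v.adicCompletion K) k = (algebraMap K _ k - x) + x by ring]
    exact Valuation.map_add_le _ hk.le hx
  obtain ⟨a, ha⟩ := exists_valuation_sub_lt_of_integer v hk1 1
  refine ⟨a, ?_⟩
  rw [show algebraMap K (v.adicCompletion K) (a : K) - x =
    algebraMap K _ ((a : K) - k) + (algebraMap K _ k - x) by rw [map_sub]; ring]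
  refine Valuation.map_add_lt _ ?_ hk
  exact (valuedAdicCompletion_eq_valuation' v ((a : K) - k)).symm ▸ ha

/-- The ring of integers is compact, being complete and discretely valued with a finite residue
field, which is a quotient of `𝓞 K ⧸ v`. -/
instance compactSpace_adicCompletionIntegers : CompactSpace (v.adicCompletionIntegers K) := by
  change CompactSpace (Valued.v : Valuation (v.adicCompletion K) ℤᵐ⁰).integer
  have hfin : Finite (𝓞 K ⧸ v.asIdeal) := v.asIdeal.finiteQuotientOfFreeOfNeBot v.ne_bot
  refine Valued.integer.compactSpace_iff_completeSpace_and_isDiscreteValuationRing_and_finite_residueField.2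
    ⟨(Valued.isClosed_integer _).completeSpace_coe,
      inferInstanceAs (IsDiscreteValuationRing (v.adicCompletionIntegers K)), ?_⟩
  let f : 𝓞 K →+* IsLocalRing.ResidueField (v.adicCompletionIntegers K) :=
    (IsLocalRing.residue _).comp (algebraMap (𝓞 K) (v.adicCompletionIntegers K))
  have hmem (y : v.adicCompletionIntegers K) :
      IsLocalRing.residue _ y = 0 ↔ Valued.v (y : v.adicCompletion K) < 1 := by
    rw [IsLocalRing.residue_eq_zero_iff]
    exact Valuation.mem_maximalIdeal_iff _ _
  have hf : ∀ a ∈ v.asIdeal, f a = 0 := fun a ha =>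
    (hmem _).2 ((valued_algebraMap_ringOfIntegers_lt_one_iff a).2 ha)
  change Finite (IsLocalRing.ResidueField (v.adicCompletionIntegers K))
  refine Finite.of_surjective (Ideal.Quotient.lift v.asIdeal f hf) fun y => ?_
  obtain ⟨x, rfl⟩ := IsLocalRing.residue_surjective y
  obtain ⟨a, ha⟩ := exists_ringOfIntegers_valued_sub_lt_one x.1 x.2
  refine ⟨Ideal.Quotient.mk _ a, ?_⟩
  rw [Ideal.Quotient.lift_mk, ← sub_eq_zero]
  change IsLocalRing.residue _ _ - _ = 0
  rw [← map_sub, hmem]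
  exact ha

/-- By compactness of the ring of integers, the set of `l`-th powers of integers is closed. -/
theorem exists_pow_eq_of_mapClusterPt {l : ℕ} {ι : Type*} {F : Filter ι}
    {y : ι → v.adicCompletion K} (hy : ∀ i, Valued.v (y i) ≤ 1) {u : v.adicCompletion K}
    (hu : MapClusterPt u F fun i => y i ^ l) : ∃ z, z ^ l = u := by
  have hc : IsCompact {x : v.adicCompletion K | Valued.v x ≤ 1} :=
    isCompact_iff_compactSpace.2 (compactSpace_adicCompletionIntegers (v := v))
  have hcl : IsClosed ((fun x : v.adicCompletion K => x ^ l) '' {x | Valued.v x ≤ 1}) :=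
    (hc.image (continuous_pow l)).isClosed
  obtain ⟨z, -, hz⟩ := hcl.mem_of_mapClusterPt hu
    (Filter.Eventually.of_forall fun i => ⟨y i, hy i, rfl⟩)
  exact ⟨z, hz⟩

theorem valued_eq_one_of_sub_one_lt_one {u : v.adicCompletion K} (hu : Valued.v (u - 1) < 1) :
    Valued.v u = 1 := by
  have := Valuation.map_add_eq_of_lt_right Valued.v (x := u - 1) (y := 1) (by simpa using hu)
  simpa using this

/-- If `u` is congruent to `1` and `m` to `0` modulo the maximal ideal, then `u ^ (m ^ k)` tends
to `1`. -/
theorem tendsto_pow_pow_of_valued_lt_one {u : v.adicCompletion K} (hu : Valued.v (u - 1) < 1)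
    {m : ℕ} (hm : Valued.v (m : v.adicCompletion K) < 1) :
    Tendsto (fun k => u ^ m ^ k) atTop (𝓝 1) := by
  set c := max (Valued.v (u - 1)) (Valued.v (m : v.adicCompletion K)) with hc
  have hc1 : c < 1 := max_lt hu hm
  obtain ⟨t, ht⟩ := valuedAdicCompletion_surjective K v c
  have key : ∀ k, Valued.v (u ^ m ^ k - 1) ≤ c ^ (k + 1) := by
    intro k
    induction k with
    | zero => simp [hc]
    | succ k ih =>
      set w := u ^ m ^ k with hw
      have hw1 : Valued.v (w - 1) ≤ c := ih.trans (pow_le_of_le_one zero_le hc1.le (by simp))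
      have hw0 : Valued.v w = 1 := valued_eq_one_of_sub_one_lt_one (hw1.trans_lt hc1)
      have hsum : Valued.v (∑ i ∈ Finset.range m, w ^ i) ≤ c := by
        have : ∑ i ∈ Finset.range m, w ^ i = ∑ i ∈ Finset.range m, (w ^ i - 1) + m := by
          simp
        rw [this]
        refine Valuation.map_add_le _ (Valuation.map_sum_le _ fun i _ => ?_) (le_max_right _ _)
        rw [← geom_sum_mul, map_mul]
        exact mul_le_of_le_one_of_le (Valuation.map_sum_le _ fun j _ => by simp [hw0]) hw1
      rw [pow_succ, pow_mul, ← hw, ← geom_sum_mul, map_mul, pow_succ' c (k + 1)]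
      exact mul_le_mul' hsum ih
  have ht0 : Tendsto (fun k : ℕ => t ^ (k + 1)) atTop (𝓝 0) :=
    (Valued.tendsto_zero_pow_of_v_lt_one (ht ▸ hc1)).comp (tendsto_add_atTop_nat 1)
  have h0 : Tendsto (fun k => u ^ m ^ k - 1) atTop (𝓝 0) := by
    intro s hs
    obtain ⟨a, ha, has⟩ := mem_nhds_zero_iff_exists_valued_lt.1 hs
    rw [Filter.mem_map]
    filter_upwards [ht0.eventually (mem_nhds_zero_iff_exists_valued_lt.2 ⟨a, ha, subset_rfl⟩)]
      with k hk
    refine has ((key k).trans_lt ?_)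
    simpa [ht] using hk
  simpa using h0.add_const 1

/-- A unit congruent to `1` is an `l`-th power if the prime `l` is not the residue characteristic.
Indeed `u ^ (m ^ k)` tends to `1` for a suitable `m` prime to `l`, and for `m ^ k ≡ 1` modulo `l`
this power differs from `u` by an `l`-th power; the `l`-th powers being closed, `u` is one. -/
theorem exists_pow_eq_of_valued_sub_one_lt_one {l : ℕ} (hl : l.Prime)
    (hvl : Valued.v (l : v.adicCompletion K) = 1) {u : v.adicCompletion K}
    (hu : Valued.v (u - 1) < 1) : ∃ z, z ^ l = u := by
  -- The part prime to `l` of the norm of `v` is a positive integer in `v`, as `l` is not in `v`.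
  obtain ⟨m, hm, hlm⟩ : ∃ m : ℕ, Valued.v (m : v.adicCompletion K) < 1 ∧ ¬ l ∣ m := by
    have hn0 : Ideal.absNorm v.asIdeal ≠ 0 := by
      rw [Ne, Ideal.absNorm_eq_zero_iff]
      exact v.ne_bot
    obtain ⟨a, m, hlm, hm⟩ := Nat.exists_eq_pow_mul_and_not_dvd hn0 l hl.ne_one
    refine ⟨m, ?_, hlm⟩
    have h := (valued_natCast_lt_one_iff (v := v) _).2 (Ideal.absNorm_mem v.asIdeal)
    rw [hm] at h
    simpa [hvl] using h
  have hu0 : Valued.v u = 1 := valued_eq_one_of_sub_one_lt_one hu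
  have hune : u ≠ 0 := by rintro rfl; simp at hu0
  have hu' : Valued.v (u⁻¹ - 1) < 1 := by
    rw [show u⁻¹ - 1 = - (u⁻¹ * (u - 1)) by field_simp; ring, Valuation.map_neg, map_mul, map_inv₀,
      hu0]
    simpa using hu
  have hmod : ∀ k : ℕ, ∃ c : ℕ, m ^ ((l - 1) * k) = 1 + l * c := by
    intro k
    have h1 : m ^ ((l - 1) * k) ≡ 1 [MOD l] := by
      rw [pow_mul, ← Nat.totient_prime hl]
      simpa using (Nat.ModEq.pow_totient ((Nat.Prime.coprime_iff_not_dvd hl).2 hlm).symm).pow k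
    have hm0 : m ≠ 0 := by rintro rfl; simp at hlm
    obtain ⟨c, hc⟩ := (Nat.modEq_iff_dvd' (Nat.one_le_iff_ne_zero.2
      (pow_ne_zero ((l - 1) * k) hm0))).1 h1.symm
    exact ⟨c, by have := Nat.one_le_iff_ne_zero.2 (pow_ne_zero ((l - 1) * k) hm0); omega⟩
  choose c hc using hmod
  have hlim : Tendsto (fun k => (u⁻¹ ^ c k) ^ l) atTop (𝓝 u) := by
    have h1 : Tendsto (fun k => u * u⁻¹ ^ m ^ ((l - 1) * k)) atTop (𝓝 (u * 1)) :=
      ((tendsto_pow_pow_of_valued_lt_one hu' hm).comp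
        (tendsto_id.const_mul_atTop' (Nat.sub_pos_of_lt hl.one_lt))).const_mul u
    rw [mul_one] at h1
    refine h1.congr fun k => ?_
    rw [hc, pow_add, pow_mul']
    field_simp
  exact exists_pow_eq_of_mapClusterPt (fun k => by simp [hu0]) hlim.mapClusterPt

end LocalField

/-! ### The residue characteristic property in completions -/

/-- A valuation strictly between those of a unit and of the `l`-th power of a uniformizer is not
congruent to zero modulo `l`. -/
theorem WithZero.pow_ne_mul_pow_of_exp_neg_lt {l : ℕ} {a b c : ℤᵐ⁰} (ha : exp (-(l : ℤ)) < a)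
    (ha1 : a < 1) (hc : c ≠ 0) : b ^ l ≠ a * c ^ l := by
  intro h
  have ha0 : a ≠ 0 := (zero_le.trans_lt ha).ne'
  have hl : l ≠ 0 := by
    rintro rfl
    simp at ha
    exact lt_asymm ha ha1
  have hb : b ≠ 0 := by
    rintro rfl
    rw [zero_pow hl, eq_comm, mul_eq_zero] at h
    exact h.elim ha0 (pow_ne_zero l hc)
  rw [← exp_log ha0, ← exp_log hb, ← exp_log hc, ← exp_nsmul, ← exp_nsmul, ← exp_add, exp_inj] at h
  rw [← exp_log ha0, exp_lt_exp] at ha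
  rw [← exp_log ha0, ← exp_zero, exp_lt_exp] at ha1
  simp only [nsmul_eq_mul] at h
  have hdvd : (l : ℤ) ∣ log a := ⟨log b - log c, by linarith⟩
  obtain ⟨k, hk⟩ := hdvd
  have hlpos : (0 : ℤ) < l := by positivity
  rw [hk] at ha ha1
  have h1 : k < 0 := by nlinarith
  nlinarith

section

variable {K : Type*} [Field K] [NumberField K] {v : HeightOneSpectrum (𝓞 K)}

/-- If the valuation of `p` is positive and less than the exponent `l`, then the set
`{x | 1 + p * x ^ l is an l-th power}` is the ring of integers. -/
theorem exists_one_add_mul_pow_eq_iff {p l : ℕ} (hl : l.Prime)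
    (hvl : Valued.v (l : v.adicCompletion K) = 1) (hp : Valued.v (p : v.adicCompletion K) < 1)
    (hpl : exp (-(l : ℤ)) < Valued.v (p : v.adicCompletion K)) (x : v.adicCompletion K) :
    (∃ y, 1 + p * x ^ l - y ^ l = 0) ↔ Valued.v x ≤ 1 := by
  constructor
  · rintro ⟨y, hy⟩
    by_contra! hx
    have hx0 : Valued.v x ≠ 0 := (zero_lt_one.trans hx).ne'
    have h1 : 1 < Valued.v ((p : v.adicCompletion K) * x ^ l) := by
      rw [map_mul, map_pow]
      have h2 : exp (1 : ℤ) ≤ Valued.v x := by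
        rw [← exp_log hx0, ← exp_zero, exp_lt_exp] at hx
        rw [← exp_log hx0, exp_le_exp]
        omega
      calc (1 : ℤᵐ⁰) = exp (-(l : ℤ)) * exp (1 : ℤ) ^ l := by
            rw [← exp_nsmul, ← exp_add]; simp
        _ < Valued.v (p : v.adicCompletion K) * exp (1 : ℤ) ^ l :=
            mul_lt_mul_of_pos_right hpl (by simp)
        _ ≤ _ := mul_le_mul_right (pow_le_pow_left' h2 l) _
    have h3 : Valued.v (1 + (p : v.adicCompletion K) * x ^ l) =
        Valued.v ((p : v.adicCompletion K) * x ^ l) :=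
      Valuation.map_add_eq_of_lt_right _ (by simpa using h1)
    rw [sub_eq_zero.1 hy, map_pow, map_mul, map_pow] at h3
    exact WithZero.pow_ne_mul_pow_of_exp_neg_lt hpl hp hx0 h3
  · intro hx
    obtain ⟨z, hz⟩ := exists_pow_eq_of_valued_sub_one_lt_one hl hvl
      (u := 1 + (p : v.adicCompletion K) * x ^ l) (by
        rw [add_sub_cancel_left, map_mul, map_pow]
        exact mul_lt_one_of_lt_of_le hp (pow_le_one' hx l))
    exact ⟨z, by rw [hz, sub_self]⟩

theorem residueCharProperty_of_valued_lt_one {p l : ℕ} (hl : l.Prime)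
    (hvl : Valued.v (l : v.adicCompletion K) = 1) (hp : Valued.v (p : v.adicCompletion K) < 1)
    (hpl : exp (-(l : ℤ)) < Valued.v (p : v.adicCompletion K)) :
    ResidueCharProperty (v.adicCompletion K) p l := by
  have key := exists_one_add_mul_pow_eq_iff hl hvl hp hpl
  refine ⟨(key _).2 hp.le, fun x x' y y' h h' => (key _).2 ?_, fun x y hx h => ?_⟩
  · rw [map_mul]
    exact mul_le_one' ((key x).1 ⟨y, h⟩) ((key x').1 ⟨y', h'⟩)
  · have h1 : Valued.v ((p : v.adicCompletion K) * x) = 1 := by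
      rw [sub_eq_zero.1 hx, map_one]
    rw [map_mul] at h1
    exact (mul_lt_one_of_lt_of_le hp ((key x).1 ⟨y, h⟩)).ne h1

/-- If `p` is a unit, then the closed set `S` of the residue characteristic property cannot contain
all powers of `p` without containing `p⁻¹`, which is a limit point of these powers. -/
theorem not_residueCharProperty_of_valued_eq_one {p l : ℕ} (hl : l ≠ 0)
    (hp : Valued.v (p : v.adicCompletion K) = 1) :
    ¬ ResidueCharProperty (v.adicCompletion K) p l := by
  rintro ⟨h1, h2, h3⟩
  have hp0 : (p : v.adicCompletion K) ≠ 0 := by intro h; simp [h] at hp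
  have hpow : ∀ n : ℕ, ∃ y : v.adicCompletion K,
      1 + p * ((p : v.adicCompletion K) ^ (n + 1)) ^ l - y ^ l = 0 := by
    intro n
    induction n with
    | zero => simpa using h1
    | succ n ih =>
      obtain ⟨y, hy⟩ := ih
      obtain ⟨y', hy'⟩ := h1
      rw [pow_succ]
      exact h2 _ _ y y' hy hy'
  choose y hy using hpow
  have hy1 : ∀ n, Valued.v (y n) ≤ 1 := by
    intro n
    have h : Valued.v (y n) ^ l ≤ 1 := by
      rw [← map_pow, ← sub_eq_zero.1 (hy n)]
      exact Valuation.map_add_le _ (by simp) (by simp [hp])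
    exact (pow_le_one_iff hl).1 h
  obtain ⟨P, hP⟩ : ∃ P : (v.adicCompletionIntegers K)ˣ,
      ((P : v.adicCompletionIntegers K) : v.adicCompletion K) = p := by
    obtain ⟨P, hP⟩ := (adicCompletionIntegers.isUnit_iff_valued_eq_one (R := 𝓞 K)
      (a := (⟨p, hp.le⟩ : v.adicCompletionIntegers K))).2 hp
    exact ⟨P, by rw [hP]⟩
  -- The powers `p ^ (n + 1)` accumulate at `p⁻¹ = p ^ (-2) * p`, the units being a compact group.
  have hcl := mapClusterPt_self_zpow_atTop_pow P (-2)
  have hcont : Continuous fun Q : (v.adicCompletionIntegers K)ˣ =>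
      1 + (p : v.adicCompletion K) * (((Q * P : (v.adicCompletionIntegers K)ˣ) :
        v.adicCompletionIntegers K) : v.adicCompletion K) ^ l := by
    have : Continuous fun Q : (v.adicCompletionIntegers K)ˣ => Q * P := continuous_mul_const P
    exact continuous_const.add (continuous_const.mul
      ((continuous_subtype_val.comp (Units.continuous_val.comp this)).pow l))
  have hcl2 := hcl.continuousAt_comp hcont.continuousAt
  have hfun : (fun Q : (v.adicCompletionIntegers K)ˣ =>
      1 + (p : v.adicCompletion K) * (((Q * P : (v.adicCompletionIntegers K)ˣ) :
        v.adicCompletionIntegers K) : v.adicCompletion K) ^ l) ∘ (fun n : ℕ => P ^ n) =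
      fun n => y n ^ l := by
    ext1 n
    have := hy n
    rw [sub_eq_zero] at this
    simp [← this, hP, pow_succ]
  rw [hfun] at hcl2
  obtain ⟨z, hz⟩ := exists_pow_eq_of_mapClusterPt hy1 hcl2
  refine h3 (((P ^ (-2 : ℤ) * P : (v.adicCompletionIntegers K)ˣ) :
        v.adicCompletionIntegers K) : v.adicCompletion K) z ?_ ?_
  · rw [← hP, sub_eq_zero]
    have : P * (P ^ (-2 : ℤ) * P) = 1 := by group
    exact congrArg (fun Q : (v.adicCompletionIntegers K)ˣ =>
      ((Q : v.adicCompletionIntegers K) : v.adicCompletion K)) this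
  · rw [hz, sub_self]

/-- A uniformizer is not a square up to sign. -/
theorem exists_ne_sq_and_ne_neg_sq (v : HeightOneSpectrum (𝓞 K)) :
    ∃ x : v.adicCompletion K, ∀ y, x ≠ y ^ 2 ∧ x ≠ - y ^ 2 := by
  obtain ⟨x, hx⟩ := valuedAdicCompletion_surjective K v (exp (-1 : ℤ))
  have h : ∀ y : v.adicCompletion K, Valued.v y ^ 2 ≠ exp (-1 : ℤ) := fun y hy =>
    WithZero.pow_ne_mul_pow_of_exp_neg_lt (l := 2) (a := exp (-1 : ℤ)) (c := 1)
      (by rw [exp_lt_exp]; norm_num) (by rw [← exp_zero, exp_lt_exp]; norm_num) one_ne_zero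
      (by simpa using hy)
  refine ⟨x, fun y => ⟨fun hy => h y ?_, fun hy => h y ?_⟩⟩
  · rw [← hx, hy, map_pow]
  · rw [← hx, hy, Valuation.map_neg, map_pow]

end

theorem not_residueCharProperty_of_forall_exists_pow_eq {F : Type*} [Field F] {p l : ℕ}
    (hp : (p : F) ≠ 0) (h : ∀ x : F, ∃ y, y ^ l = x) : ¬ ResidueCharProperty F p l := by
  rintro ⟨-, -, h3⟩
  obtain ⟨y, hy⟩ := h (1 + p * (p : F)⁻¹ ^ l)
  exact h3 (p : F)⁻¹ y (by rw [mul_inv_cancel₀ hp, sub_self]) (by rw [hy, sub_self])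

/-! ### Integral homomorphisms between completions -/

section

variable {K L : Type*} [Field K] [NumberField K] [Field L] [NumberField L]
  {v : HeightOneSpectrum (𝓞 K)} {w : HeightOneSpectrum (𝓞 L)}

/-- A ring homomorphism between completions is integral if it respects the rings of integers. -/
def IsIntegralHom (φ : v.adicCompletion K →+* w.adicCompletion L) : Prop :=
  ∀ x, Valued.v x ≤ 1 → Valued.v (φ x) ≤ 1

theorem natCast_adicCompletion_ne_zero {p : ℕ} (hp : p ≠ 0) : (p : v.adicCompletion K) ≠ 0 := by
  rw [← map_natCast (algebraMap K (v.adicCompletion K)) p]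
  exact (map_ne_zero _).2 (Nat.cast_ne_zero.2 hp)

theorem exists_prime_mem_asIdeal (v : HeightOneSpectrum (𝓞 K)) :
    ∃ p : ℕ, p.Prime ∧ (p : 𝓞 K) ∈ v.asIdeal := by
  have h0 : Ideal.absNorm v.asIdeal ≠ 0 := by
    rw [Ne, Ideal.absNorm_eq_zero_iff]; exact v.ne_bot
  have h := Ideal.absNorm_mem v.asIdeal
  generalize Ideal.absNorm v.asIdeal = n at h h0
  induction n using Nat.recOnMul with
  | zero => exact absurd rfl h0
  | one => exact absurd ((Ideal.eq_top_iff_one _).2 (by simpa using h)) v.isPrime.ne_top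
  | prime p hp => exact ⟨p, hp, h⟩
  | mul a b ha hb =>
    rw [Nat.cast_mul] at h
    obtain ⟨ha0, hb0⟩ := mul_ne_zero_iff.1 h0
    exact (v.isPrime.mem_or_mem h).elim (ha · ha0) (hb · hb0)

/-- A homomorphism into a completion above `p` which maps integers to integers maps sufficiently
high powers of `p` and their multiples into a given neighbourhood of zero. -/
theorem exists_natCast_pow_of_mem_nhds_zero {F : Type*} [Field F] {Γ : Type*}
    [LinearOrderedCommGroupWithZero Γ] (V : Valuation F Γ) (φ : F →+* w.adicCompletion L)
    (hφ : ∀ x, V x ≤ 1 → Valued.v (φ x) ≤ 1) {p : ℕ} (hp : (p : F) ≠ 0)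
    (hw : Valued.v (p : w.adicCompletion L) < 1) {s : Set (w.adicCompletion L)}
    (hs : s ∈ 𝓝 0) : ∃ k : ℕ, ∀ x, V x ≤ V ((p : F) ^ k) → φ x ∈ s := by
  obtain ⟨a, ha, has⟩ := mem_nhds_zero_iff_exists_valued_lt.1 hs
  obtain ⟨k, hk⟩ := ((Valued.tendsto_zero_pow_of_v_lt_one hw).eventually
    (mem_nhds_zero_iff_exists_valued_lt.2 ⟨a, ha, subset_rfl⟩)).exists
  refine ⟨k, fun x hx => has (lt_of_le_of_lt ?_ hk)⟩
  have h1 : Valued.v (φ (x / (p : F) ^ k)) ≤ 1 := by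
    refine hφ _ ?_
    rw [map_div₀]
    exact div_le_one_of_le₀ hx zero_le
  have h2 : φ x = φ (x / (p : F) ^ k) * (p : w.adicCompletion L) ^ k := by
    rw [← map_natCast φ p, ← map_pow, ← map_mul, div_mul_cancel₀ _ (pow_ne_zero k hp)]
  rw [h2, map_mul]
  exact mul_le_of_le_one_left' h1

namespace IsIntegralHom

variable {φ : v.adicCompletion K →+* w.adicCompletion L}

protected theorem continuous (hφ : IsIntegralHom φ) : Continuous φ := by
  obtain ⟨p, hp, hpw⟩ := exists_prime_mem_asIdeal w
  have hw := (valued_natCast_lt_one_iff (v := w) p).2 hpw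
  refine continuous_of_tendsto_nhds_zero φ fun s hs => ?_
  obtain ⟨k, hk⟩ := exists_natCast_pow_of_mem_nhds_zero _ φ hφ
    (natCast_adicCompletion_ne_zero hp.ne_zero) hw hs
  exact mem_nhds_zero_iff_exists_valued_lt.2
    ⟨_, pow_ne_zero k (natCast_adicCompletion_ne_zero hp.ne_zero), fun x hx => hk x hx.le⟩

theorem valued_lt_one (hφ : IsIntegralHom φ) {x : v.adicCompletion K} (hx : Valued.v x < 1) :
    Valued.v (φ x) < 1 := by
  have h : Tendsto (fun n : ℕ => φ (x ^ n)) atTop (𝓝 0) := by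
    have := (hφ.continuous.tendsto 0).comp (Valued.tendsto_zero_pow_of_v_lt_one hx)
    rwa [map_zero] at this
  obtain ⟨n, hn⟩ := (h.eventually
    (mem_nhds_zero_iff_exists_valued_lt.2 ⟨1, one_ne_zero, subset_rfl⟩)).exists
  rw [map_pow, map_pow, map_one] at hn
  exact lt_of_not_ge fun h1 => absurd (one_le_pow₀ h1) (not_le.2 hn)

theorem valued_le_one_of_map (hφ : IsIntegralHom φ) {x : v.adicCompletion K}
    (hx : Valued.v (φ x) ≤ 1) : Valued.v x ≤ 1 := by
  by_contra! h
  have h1 := hφ.valued_lt_one (x := x⁻¹) (by rw [map_inv₀]; exact inv_lt_one_of_one_lt₀ h)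
  rw [map_inv₀, map_inv₀] at h1
  have h0 : Valued.v (φ x) ≠ 0 := by
    rw [Valuation.ne_zero_iff, map_ne_zero]
    rintro rfl
    simp at h
  exact absurd hx (not_le.2 ((inv_lt_one₀ (zero_lt_iff.2 h0)).1 h1))

/-- An integral endomorphism is onto. It permutes the finitely many roots of a rational polynomial,
so that its image contains the algebraic elements and in particular the dense subfield `K`; and
the image of the compact ring of integers is closed. -/
theorem surjective {σ : v.adicCompletion K →+* v.adicCompletion K} (hσ : IsIntegralHom σ) :
    Function.Surjective σ := by
  have hK : ∀ x : K, ∃ y, σ y = algebraMap K (v.adicCompletion K) x := by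
    intro x
    have hx : IsIntegral ℚ x := Algebra.IsIntegral.isIntegral x
    let Z : Set (v.adicCompletion K) := (minpoly ℚ x).rootSet (v.adicCompletion K)
    have hmaps : Set.MapsTo σ Z Z := by
      intro z hz
      have h0 := minpoly.ne_zero hx
      rw [Polynomial.mem_rootSet_of_ne h0] at hz ⊢
      have := Polynomial.aeval_algHom_apply σ.toRatAlgHom z (minpoly ℚ x)
      rwa [hz, map_zero] at this
    have hfin : Finite Z := (minpoly ℚ x).rootSet_finite _
    have hsurj : Function.Surjective (hmaps.restrict σ Z Z) :=
      Finite.injective_iff_surjective.1 (hmaps.restrict_inj.2 σ.injective.injOn)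
    have hxZ : algebraMap K (v.adicCompletion K) x ∈ Z := by
      rw [Polynomial.mem_rootSet_of_ne (minpoly.ne_zero hx),
        Polynomial.aeval_algebraMap_apply, minpoly.aeval, map_zero]
    obtain ⟨y, hy⟩ := hsurj ⟨_, hxZ⟩
    exact ⟨y, congrArg Subtype.val hy⟩
  have hc : IsCompact {x : v.adicCompletion K | Valued.v x ≤ 1} :=
    isCompact_iff_compactSpace.2 (compactSpace_adicCompletionIntegers (v := v))
  have hcl := (hc.image hσ.continuous).isClosed
  have hint : ∀ x, Valued.v x ≤ 1 → ∃ y, σ y = x := by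
    intro x hx
    suffices h : x ∈ σ '' {x | Valued.v x ≤ 1} by
      obtain ⟨y, -, hy⟩ := h
      exact ⟨y, hy⟩
    rw [← hcl.closure_eq, mem_closure_iff_nhds]
    intro t ht
    obtain ⟨_, ⟨k, rfl⟩, hkt, hkx⟩ := (denseRange_algebraMap (R := 𝓞 K) K v).inter_nhds_nonempty
      (Filter.inter_mem ht (setOf_valued_sub_lt_mem_nhds one_ne_zero x))
    obtain ⟨y, hy⟩ := hK k
    replace hkx : Valued.v (algebraMap K (v.adicCompletion K) k - x) < 1 := by simpa using hkx
    refine ⟨_, hkt, y, hσ.valued_le_one_of_map ?_, hy⟩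
    rw [hy, show algebraMap K (v.adicCompletion K) k = (algebraMap K _ k - x) + x by ring]
    exact Valuation.map_add_le _ hkx.le hx
  intro x
  rcases le_or_gt (Valued.v x) 1 with hx | hx
  · exact hint x hx
  · obtain ⟨y, hy⟩ := hint x⁻¹ (by rw [map_inv₀]; exact (inv_lt_one_of_one_lt₀ hx).le)
    exact ⟨y⁻¹, by rw [map_inv₀, hy, inv_inv]⟩

/-- Two completions which embed integrally into each other are isomorphic, topologically and with
their rings of integers. -/
theorem exists_ringEquiv (hφ : IsIntegralHom φ) {ψ : w.adicCompletion L →+* v.adicCompletion K}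
    (hψ : IsIntegralHom ψ) : ∃ e : v.adicCompletion K ≃+* w.adicCompletion L,
      Continuous e ∧ Continuous e.symm ∧ ∀ x, Valued.v (e x) ≤ 1 ↔ Valued.v x ≤ 1 := by
  have hs : Function.Surjective φ :=
    Function.Surjective.of_comp (g := ψ)
      (surjective (σ := φ.comp ψ) fun x hx => hφ _ (hψ x hx))
  let e := RingEquiv.ofBijective φ ⟨φ.injective, hs⟩
  have he : ∀ x, Valued.v (e x) ≤ 1 ↔ Valued.v x ≤ 1 := fun x =>
    ⟨fun h => hφ.valued_le_one_of_map h, fun h => hφ x h⟩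
  refine ⟨e, hφ.continuous, ?_, he⟩
  have : IsIntegralHom (e.symm : w.adicCompletion L →+* v.adicCompletion K) := fun x hx =>
    (he _).1 (by simpa using hx)
  exact this.continuous

end IsIntegralHom

/-- A homomorphism from `K` to a completion which maps the elements integral at `v` to integers
extends to the completion at `v`. -/
theorem exists_isIntegralHom_of_valuation_le_one (ι : K →+* w.adicCompletion L)
    (hι : ∀ x, v.valuation K x ≤ 1 → Valued.v (ι x) ≤ 1) :
    ∃ φ : v.adicCompletion K →+* w.adicCompletion L, IsIntegralHom φ := by
  obtain ⟨p, hp, hpw⟩ := exists_prime_mem_asIdeal w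
  have hw := (valued_natCast_lt_one_iff (v := w) p).2 hpw
  let i : WithVal (v.valuation K) →+* v.adicCompletion K :=
    (algebraMap K (v.adicCompletion K)).comp (WithVal.equiv (v.valuation K)).toRingHom
  let f : WithVal (v.valuation K) →+* w.adicCompletion L :=
    ι.comp (WithVal.equiv (v.valuation K)).toRingHom
  have hvi (x : WithVal (v.valuation K)) :
      Valued.v (i x) = v.valuation K (WithVal.equiv (v.valuation K) x) :=
    valuedAdicCompletion_eq_valuation' v _
  have ui : IsUniformInducing i := by
    rw [← (adicCompletion.isUniformInducing_toCompletion K v).of_comp_iff]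
    exact UniformSpace.Completion.isUniformInducing_coe _
  have di : DenseRange i := by
    rw [DenseRange, show Set.range i = Set.range (algebraMap K (v.adicCompletion K)) from
      (WithVal.equiv (v.valuation K)).surjective.range_comp
        (algebraMap K (v.adicCompletion K))]
    exact denseRange_algebraMap (R := 𝓞 K) K v
  have hf : UniformContinuous f := by
    refine uniformContinuous_addMonoidHom_of_continuous
      (continuous_of_tendsto_nhds_zero f fun s hs => ?_)
    obtain ⟨k, hk⟩ := exists_natCast_pow_of_mem_nhds_zero _ ι hι
      (Nat.cast_ne_zero.2 hp.ne_zero) hw hs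
    rw [Filter.mem_map, ui.isInducing.nhds_eq_comap, map_zero]
    refine ⟨_, mem_nhds_zero_iff_exists_valued_lt.2
      ⟨_, pow_ne_zero k (natCast_adicCompletion_ne_zero hp.ne_zero), subset_rfl⟩, fun x hx => ?_⟩
    refine hk _ ?_
    have h1 : Valued.v (i x) < Valued.v ((p : v.adicCompletion K) ^ k) := hx
    rw [hvi] at h1
    refine h1.le.trans_eq ?_
    rw [← map_natCast i p, ← map_pow, hvi]
    simp
  let φ := IsDenseInducing.extendRingHom ui di hf
  have hφc : Continuous φ := (uniformContinuous_uniformly_extend ui di hf).continuous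
  have hφi (x : WithVal (v.valuation K)) : φ (i x) = f x :=
    IsDenseInducing.extend_eq (ui.isDenseInducing di) hf.continuous x
  refine ⟨φ, fun x hx => ?_⟩
  obtain ⟨_, ⟨k, rfl⟩, hk1, hk2⟩ := di.inter_nhds_nonempty
    (Filter.inter_mem (setOf_valued_sub_lt_mem_nhds one_ne_zero x)
      (hφc.continuousAt (setOf_valued_sub_lt_mem_nhds one_ne_zero (φ x))))
  replace hk1 : Valued.v (i k - x) < 1 := by simpa using hk1
  replace hk2 : Valued.v (φ (i k) - φ x) < 1 := by simpa using hk2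
  have h1 : Valued.v (i k) ≤ 1 := by
    rw [show i k = (i k - x) + x by ring]
    exact Valuation.map_add_le _ hk1.le hx
  rw [show φ x = φ (i k) - (φ (i k) - φ x) by ring]
  refine Valuation.map_sub_le _ ?_ hk2.le
  rw [hφi]
  exact hι _ (hvi k ▸ h1)

end

/-! ### Polynomials which detect embeddings of a completion -/

section

variable {K L : Type*} [Field K] [NumberField K] [Field L] [NumberField L]
  {v : HeightOneSpectrum (𝓞 K)} {w : HeightOneSpectrum (𝓞 L)}

/-- A generator `θ` of the number field `K` separates the prime `v` from the other primes above `p`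
if it is congruent to `1` modulo `v` and to `p` modulo `p ^ 2` at all the other primes above `p`. The last
condition is expressed by the divisibility of `a * (θ - p)` by `p ^ 2` for all `a` in a power
of `v`. -/
structure IsSeparatingGenerator (v : HeightOneSpectrum (𝓞 K)) (p : ℕ) (θ : 𝓞 K) : Prop where
  adjoin_eq_top : IntermediateField.adjoin ℚ {(θ : K)} = ⊤
  sub_one_mem : θ - 1 ∈ v.asIdeal
  exists_dvd : ∃ n : ℕ, ∀ a ∈ v.asIdeal ^ n, (p : 𝓞 K) ^ 2 ∣ a * (θ - p)

theorem exists_ringOfIntegers_adjoin_eq_top (K : Type*) [Field K] [NumberField K] :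
    ∃ t : 𝓞 K, IntermediateField.adjoin ℚ {(t : K)} = ⊤ := by
  obtain ⟨α, hα⟩ := Field.exists_primitive_element ℚ K
  obtain ⟨d, hd, hint⟩ := ((IsFractionRing.isAlgebraic_iff ℤ ℚ K).2
    (Algebra.IsAlgebraic.isAlgebraic (R := ℚ) α)).exists_integral_multiple
  refine ⟨⟨d • α, hint⟩, ?_⟩
  rw [eq_top_iff, ← hα, IntermediateField.adjoin_simple_le_iff]
  have h := IntermediateField.mem_adjoin_simple_self ℚ (d • α)
  have h2 := (IntermediateField.adjoin ℚ {d • α}).smul_mem h (x := (d : ℚ)⁻¹)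
  rwa [← Int.cast_smul_eq_zsmul ℚ d α, inv_smul_smul₀ (Int.cast_ne_zero.2 hd),
    Int.cast_smul_eq_zsmul ℚ d α] at h2

/-- The conditions at the primes above `p` hold for some `θ` by coprimality, and are not affected by
adding multiples of `p ^ 2`; almost all of these changes make `θ` a generator, because `K` has only
finitely many subfields. -/
theorem exists_isSeparatingGenerator {p : ℕ} (hp : p ≠ 0) (hpv : (p : 𝓞 K) ∈ v.asIdeal) :
    ∃ θ, IsSeparatingGenerator v p θ := by
  have hp2 : (p : 𝓞 K) ^ 2 ≠ 0 := pow_ne_zero 2 (Nat.cast_ne_zero.2 hp)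
  obtain ⟨n, J, hJ, hvJ⟩ : ∃ (n : ℕ) (J : Ideal (𝓞 K)),
      Ideal.span {(p : 𝓞 K) ^ 2} = v.asIdeal ^ n * J ∧ ¬ J ≤ v.asIdeal := by
    have hI : Ideal.span {(p : 𝓞 K) ^ 2} ≠ 0 := by simpa using hp
    obtain ⟨J, hJ, hvJ⟩ := (FiniteMultiplicity.of_not_isUnit
      v.irreducible.not_isUnit hI).exists_eq_pow_mul_and_not_dvd
    exact ⟨_, J, hJ, fun h => hvJ (Ideal.dvd_iff_le.2 h)⟩
  obtain ⟨j, hj, hjv⟩ := SetLike.not_le_iff_exists.1 hvJ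
  obtain ⟨y, i, hi, hyi⟩ := v.isMaximal.exists_inv hjv
  have hdvd : ∀ a ∈ v.asIdeal ^ n, (p : 𝓞 K) ^ 2 ∣ a * (y * j) := by
    intro a ha
    rw [← Ideal.mem_span_singleton, hJ]
    exact Ideal.mul_mem_mul ha (J.mul_mem_left y hj)
  obtain ⟨t, ht⟩ := exists_ringOfIntegers_adjoin_eq_top K
  let θ : ℕ → 𝓞 K := fun k => p + y * j + (p : 𝓞 K) ^ 2 * (k * t)
  have hfin : Finite (IntermediateField ℚ K) :=
    Field.finite_intermediateField_of_exists_primitive_element ℚ K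
      (Field.exists_primitive_element ℚ K)
  obtain ⟨k, k', hkk, heq⟩ := Finite.exists_ne_map_eq_of_infinite
    fun k : ℕ => IntermediateField.adjoin ℚ {(θ k : K)}
  refine ⟨θ k, ?_, ?_, n, fun a ha => ?_⟩
  · rw [eq_top_iff, ← ht, IntermediateField.adjoin_simple_le_iff]
    have h1 : (θ k : K) ∈ IntermediateField.adjoin ℚ {(θ k : K)} :=
      IntermediateField.mem_adjoin_simple_self ℚ _
    have h2 : (θ k' : K) ∈ IntermediateField.adjoin ℚ {(θ k : K)} :=
      heq ▸ IntermediateField.mem_adjoin_simple_self ℚ _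
    have hc : ((p : ℚ) ^ 2 * ((k : ℚ) - k')) ≠ 0 :=
      mul_ne_zero (pow_ne_zero 2 (Nat.cast_ne_zero.2 hp))
        (sub_ne_zero.2 (Nat.cast_injective.ne hkk))
    have h3 := (IntermediateField.adjoin ℚ {(θ k : K)}).smul_mem (sub_mem h1 h2)
      (x := ((p : ℚ) ^ 2 * ((k : ℚ) - k'))⁻¹)
    have h4 : (θ k : K) - θ k' = ((p : ℚ) ^ 2 * ((k : ℚ) - k')) • (t : K) := by
      simp only [θ, map_add, map_mul, map_natCast, map_pow, Algebra.smul_def, map_sub]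
      ring
    rwa [h4, inv_smul_smul₀ hc] at h3
  · rw [show θ k - 1 = p * (1 + p * (k * t)) - i by
      rw [eq_sub_of_add_eq' hyi]; simp only [θ]; ring]
    exact sub_mem (Ideal.mul_mem_right _ _ hpv) hi
  · rw [show a * (θ k - p) = a * (y * j) + (p : 𝓞 K) ^ 2 * (a * (k * t)) by simp only [θ]; ring]
    exact dvd_add (hdvd a ha) (dvd_mul_right _ _)

/-- The polynomial whose roots are the `l`-th roots of the conjugates of `θ`. For a separating
generator `θ` of a place `v` above `p` and a suitable prime `l`, it has a root in a completion above
`p` if and only if the completion at `v` embeds there. -/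
noncomputable def rootPolynomial (l : ℕ) (θ : 𝓞 K) : Polynomial ℤ :=
  Polynomial.expand ℤ l (minpoly ℤ θ)

theorem eval₂_rootPolynomial {F : Type*} [Field F] (l : ℕ) (θ : 𝓞 F) {R : Type*} [CommRing R]
    (y : R) :
    (rootPolynomial l θ).eval₂ (Int.castRingHom R) y =
      (minpoly ℤ θ).eval₂ (Int.castRingHom R) (y ^ l) := by
  rw [rootPolynomial, Polynomial.expand_eq_comp_X_pow, Polynomial.eval₂_comp]
  simp

/-- Algebraic integers are mapped to integral elements, since the ring of integers of the completion
is integrally closed. -/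
theorem valued_map_ringOfIntegers_le_one {F : Type*} [Field F] (ι : F →+* w.adicCompletion L)
    (a : 𝓞 F) : Valued.v (ι (a : F)) ≤ 1 := by
  obtain ⟨f, hf, hfa⟩ := NumberField.RingOfIntegers.isIntegral_coe a
  refine (adicCompletionIntegers.integers L w).mem_of_integral
    ⟨f.map (Int.castRingHom _), hf.map _, ?_⟩
  have h := congrArg ι hfa
  rw [Polynomial.hom_eval₂, map_zero] at h
  rw [Polynomial.eval₂_map, ← h]
  congr 1
  exact RingHom.ext_int _ _

namespace IsSeparatingGenerator

variable {p : ℕ} {θ : 𝓞 K}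

/-- As `θ` is congruent to `1` modulo `v`, it is an `l`-th power in the completion at `v`. -/
theorem exists_aeval_eq_zero (hθ : IsSeparatingGenerator v p θ) {l : ℕ} (hl : l.Prime)
    (hvl : Valued.v (l : v.adicCompletion K) = 1) :
    ∃ y : v.adicCompletion K, (rootPolynomial l θ).eval₂ (Int.castRingHom _) y = 0 := by
  obtain ⟨z, hz⟩ := exists_pow_eq_of_valued_sub_one_lt_one hl hvl
    (u := algebraMap K (v.adicCompletion K) (θ : K)) (by
      simpa using (valued_algebraMap_ringOfIntegers_lt_one_iff (v := v) (θ - 1)).2 hθ.sub_one_mem)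
  refine ⟨z, ?_⟩
  have h := Polynomial.hom_eval₂ (minpoly ℤ θ) (Int.castRingHom (𝓞 K))
    ((algebraMap K (v.adicCompletion K)).comp (algebraMap (𝓞 K) K)) θ
  have h0 : Polynomial.eval₂ (Int.castRingHom (𝓞 K)) θ (minpoly ℤ θ) = 0 := minpoly.aeval ℤ θ
  rw [h0, map_zero] at h
  rw [eval₂_rootPolynomial, hz]
  refine Eq.trans ?_ h.symm
  congr 1
  exact RingHom.ext_int _ _

/-- If a root of `rootPolynomial l θ` generates an embedding of `K` into the completion of `L` at a
prime `w` above `p`, then the restriction of `w` to `K` is `v`: at any other prime, `θ` would have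
the same valuation as `p`, and this valuation is not divisible by `l`. -/
theorem exists_isIntegralHom (hθ : IsSeparatingGenerator v p θ) {l : ℕ}
    (hw : Valued.v (p : w.adicCompletion L) < 1)
    (hwl : exp (-(l : ℤ)) < Valued.v (p : w.adicCompletion L))
    (hroot : ∃ y : w.adicCompletion L, (rootPolynomial l θ).eval₂ (Int.castRingHom _) y = 0) :
    ∃ φ : v.adicCompletion K →+* w.adicCompletion L, IsIntegralHom φ := by
  obtain ⟨y, hy⟩ := hroot
  rw [eval₂_rootPolynomial] at hy
  have hint : IsIntegral ℚ (θ : K) := Algebra.IsIntegral.isIntegral _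
  have hmin : minpoly ℚ (θ : K) = (minpoly ℤ θ).map (algebraMap ℤ ℚ) := by
    rw [← minpoly.isIntegrallyClosed_eq_field_fractions ℚ K (NumberField.RingOfIntegers.isIntegral θ)]
  have hy' : y ^ l ∈ (minpoly ℚ (θ : K)).aroots (w.adicCompletion L) := by
    rw [Polynomial.mem_aroots, Polynomial.aeval_def, hmin, Polynomial.eval₂_map]
    refine ⟨hmin ▸ minpoly.ne_zero hint, ?_⟩
    rwa [RingHom.ext_int ((algebraMap ℚ (w.adicCompletion L)).comp (algebraMap ℤ ℚ))
      (Int.castRingHom _)]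
  obtain ⟨ι, hι⟩ : ∃ ι : K →+* w.adicCompletion L, ι (θ : K) = y ^ l := by
    let f := (IntermediateField.algHomAdjoinIntegralEquiv ℚ hint).symm ⟨y ^ l, hy'⟩
    let g : K →ₐ[ℚ] IntermediateField.adjoin ℚ {(θ : K)} :=
      ((IntermediateField.equivOfEq hθ.adjoin_eq_top).trans
        IntermediateField.topEquiv).symm.toAlgHom
    refine ⟨(f.comp g).toRingHom, ?_⟩
    have hg : g (θ : K) = IntermediateField.AdjoinSimple.gen ℚ (θ : K) := rfl
    exact (congrArg f hg).trans
      (IntermediateField.algHomAdjoinIntegralEquiv_symm_apply_gen ℚ hint ⟨y ^ l, hy'⟩)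
  have hle := valued_map_ringOfIntegers_le_one (w := w) ι
  have hlt : ∀ a ∈ v.asIdeal, Valued.v (ι (a : K)) < 1 := by
    intro a ha
    refine lt_of_le_of_ne (hle a) fun ha1 => ?_
    obtain ⟨n, hn⟩ := hθ.exists_dvd
    obtain ⟨c, hc⟩ := hn _ (Ideal.pow_mem_pow ha n)
    have h1 : Valued.v (ι ((θ - p : 𝓞 K) : K)) ≤ Valued.v (p : w.adicCompletion L) ^ 2 := by
      have h2 := congrArg (fun b : 𝓞 K => Valued.v (ι (b : K))) hc
      simp only [map_mul, map_pow, ha1, one_pow, one_mul, map_natCast] at h2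
      rw [h2]
      exact mul_le_of_le_one_right' (hle c)
    have h3 : Valued.v (ι (θ : K)) = Valued.v (p : w.adicCompletion L) := by
      refine Valuation.map_eq_of_sub_lt _ ?_
      simp only [map_sub, map_natCast] at h1
      refine h1.trans_lt ?_
      rw [sq]
      exact mul_lt_of_lt_one_left (zero_le.trans_lt hwl) hw
    rw [hι, map_pow] at h3
    exact WithZero.pow_ne_mul_pow_of_exp_neg_lt hwl hw one_ne_zero (h3.trans (by simp))
  have heq : ∀ a ∉ v.asIdeal, Valued.v (ι (a : K)) = 1 := by
    intro a ha
    refine le_antisymm (hle a) ?_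
    obtain ⟨b, i, hi, hbi⟩ := v.isMaximal.exists_inv ha
    have h1 : Valued.v (ι ((b * a : 𝓞 K) : K)) = 1 := by
      rw [eq_sub_of_add_eq hbi]
      simp only [map_sub, map_one]
      have := Valuation.map_sub_eq_of_lt_left (v := (Valued.v : Valuation (w.adicCompletion L) ℤᵐ⁰))
        (x := 1) (y := ι (i : K)) (by simpa using hlt i hi)
      simpa using this
    simp only [map_mul] at h1
    rw [← h1]
    exact mul_le_of_le_one_left' (hle b)
  refine exists_isIntegralHom_of_valuation_le_one ι fun x hx => ?_
  obtain ⟨n, d, hnd⟩ := exists_primeCompl_mul_eq_of_integer v x hx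
  have h1 := congrArg (fun b : K => Valued.v (ι b)) hnd
  simp only [map_mul] at h1
  have h2 : Valued.v (ι (algebraMap (𝓞 K) K d)) = 1 := heq d d.2
  have h3 := hle n
  simp_all

end IsSeparatingGenerator

end

/-! ### Matching two finite families in an ordered set -/

section Matching

variable {A B C Q : Type*} [PartialOrder Q]

/-- The members of a family above `q` are partitioned by their values. -/
def sigmaFiberLtEquiv (k : C → Q) (q : Q) :
    (Σ q' : {q' // q < q'}, {c // k c = q'.1}) ≃ {c // q < k c} where
  toFun x := ⟨x.2.1, x.2.2.symm ▸ x.1.2⟩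
  invFun c := ⟨⟨k c, c.2⟩, ⟨c, rfl⟩⟩
  left_inv := by
    rintro ⟨⟨q', hq'⟩, c, hc⟩
    obtain rfl : k c = q' := hc
    rfl
  right_inv _ := rfl

theorem card_le_eq_card_eq_add_card_lt [Finite C] (k : C → Q) (q : Q) :
    Nat.card {c // q ≤ k c} = Nat.card {c // k c = q} + Nat.card {c // q < k c} := by
  have : {c | q ≤ k c} = {c | k c = q} ∪ {c | q < k c} := by
    ext c
    simp [le_iff_eq_or_lt, eq_comm]
  refine (congrArg Set.ncard this).trans (Set.ncard_union_eq ?_)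
  rw [Set.disjoint_left]
  exact fun c hc hc' => hc'.ne' hc

theorem card_lt_le_card_lt [Finite C] (k : C → Q) {q q' : Q} (h : q < q') :
    Nat.card {c // q' < k c} ≤ Nat.card {c // q < k c} :=
  Nat.card_mono (Set.toFinite {c | q < k c}) fun _ hc => h.trans hc

theorem card_lt_lt_card_lt [Finite C] (k : C → Q) {q : Q} {c : C} (h : q < k c) :
    Nat.card {c' // k c < k c'} < Nat.card {c' // q < k c'} :=
  Set.ncard_lt_ncard (s := {c' | k c < k c'}) (t := {c' | q < k c'})
    ⟨fun _ hc => h.trans hc, fun hsub => lt_irrefl (k c) (hsub h)⟩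

/-- Two finite families in a partially ordered set agree up to reindexing if they have equally many
members above each of their values. This holds by induction from the top: members above `q` are
those equal to `q` and those with larger values. -/
theorem exists_equiv_of_card_le_eq [Finite A] [Finite B] (f : A → Q) (h : B → Q)
    (hc : ∀ q, q ∈ Set.range f ∪ Set.range h →
      Nat.card {a // q ≤ f a} = Nat.card {b // q ≤ h b}) :
    ∃ σ : A ≃ B, ∀ a, h (σ a) = f a := by
  have hempty : ∀ q ∉ Set.range f ∪ Set.range h, Nonempty ({a // f a = q} ≃ {b // h b = q}) := by
    intro q hq
    rw [Set.mem_union, not_or] at hq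
    have : IsEmpty {a // f a = q} := ⟨fun a => hq.1 ⟨a, a.2⟩⟩
    have : IsEmpty {b // h b = q} := ⟨fun b => hq.2 ⟨b, b.2⟩⟩
    exact ⟨Equiv.equivOfIsEmpty _ _⟩
  have key : ∀ (n : ℕ) (q : Q), Nat.card {a // q < f a} + Nat.card {b // q < h b} ≤ n →
      Nonempty ({a // f a = q} ≃ {b // h b = q}) := by
    intro n
    induction n using Nat.strong_induction_on with
    | _ n ih =>
      intro q hq
      by_cases hqr : q ∈ Set.range f ∪ Set.range h
      swap
      · exact hempty q hqr
      have hgt : ∀ q' : {q' // q < q'}, Nonempty ({a // f a = q'.1} ≃ {b // h b = q'.1}) := by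
        rintro ⟨q', hq'⟩
        by_cases hqr' : q' ∈ Set.range f ∪ Set.range h
        swap
        · exact hempty q' hqr'
        refine ih _ (lt_of_lt_of_le ?_ hq) q' le_rfl
        rcases hqr' with ⟨a, rfl⟩ | ⟨b, rfl⟩
        · exact add_lt_add_of_lt_of_le (card_lt_lt_card_lt f hq') (card_lt_le_card_lt h hq')
        · exact add_lt_add_of_le_of_lt (card_lt_le_card_lt f hq') (card_lt_lt_card_lt h hq')
      have hcard : Nat.card {a // q < f a} = Nat.card {b // q < h b} :=
        Nat.card_congr ((sigmaFiberLtEquiv f q).symm.trans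
          ((Equiv.sigmaCongrRight fun q' => (hgt q').some).trans (sigmaFiberLtEquiv h q)))
      have := hc q hqr
      rw [card_le_eq_card_eq_add_card_lt f, card_le_eq_card_eq_add_card_lt h, hcard] at this
      exact Finite.card_eq.1 (Nat.add_right_cancel this)
  let σ : A ≃ B := (Equiv.sigmaFiberEquiv f).symm.trans
    ((Equiv.sigmaCongrRight fun q => (key _ q le_rfl).some).trans (Equiv.sigmaFiberEquiv h))
  exact ⟨σ, fun a => ((key _ (f a) le_rfl).some ⟨a, rfl⟩).2⟩

end Matching

open NumberField

/-! ### Minimal idempotents of the adele ring -/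

section Product

variable {A I : Type*} [CommRing A] {F : I → Type*} [∀ i, Field (F i)] {π : ∀ i, A →+* F i}
  {e : I → A}

/-- The maps `π i` exhibit the ring `A` as a subring of a product of fields, with surjective
projections, and `e i` is the indicator function of the factor with index `i`. -/
structure IsSubdirectProduct (π : ∀ i, A →+* F i) (e : I → A) : Prop where
  eq_zero : ∀ a, (∀ i, π i a = 0) → a = 0
  surjective : ∀ i, Function.Surjective (π i)
  apply_self : ∀ i, π i (e i) = 1
  apply_of_ne : ∀ i j, j ≠ i → π j (e i) = 0

namespace IsSubdirectProduct

theorem ext (h : IsSubdirectProduct π e) {a b : A} (hab : ∀ i, π i a = π i b) : a = b :=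
  sub_eq_zero.1 (h.eq_zero _ fun i => by rw [map_sub, hab, sub_self])

theorem isComponent (h : IsSubdirectProduct π e) (i : I) : IsComponent (e i) (π i) := by
  refine ⟨h.surjective i, fun a => ⟨fun ha => ?_, fun ha => h.eq_zero _ fun j => ?_⟩⟩
  · simpa [h.apply_self] using congrArg (π i) ha
  · by_cases hj : j = i
    · subst hj; simp [ha]
    · simp [h.apply_of_ne i j hj]

theorem injective (h : IsSubdirectProduct π e) : Function.Injective e := by
  intro i j hij
  by_contra hne
  have := h.apply_of_ne j i hne
  rw [← hij, h.apply_self] at this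
  exact one_ne_zero this

theorem isMinimalIdempotent (h : IsSubdirectProduct π e) (i : I) : IsMinimalIdempotent (e i) := by
  have hcases : ∀ j, π j (e i) = 0 ∨ π j (e i) = 1 := fun j => by
    by_cases hj : j = i
    · subst hj; exact Or.inr (h.apply_self j)
    · exact Or.inl (h.apply_of_ne i j hj)
  refine ⟨h.ext fun j => ?_, fun h0 => ?_, fun f hf => ?_⟩
  · rcases hcases j with hj | hj <;> simp [hj]
  · simpa [h0] using h.apply_self i
  · have hfi : π i f = 0 ∨ π i f = 1 := by
      have := congrArg (π i) hf
      rw [map_mul] at this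
      exact IsIdempotentElem.iff_eq_zero_or_one.1 this
    refine hfi.imp (fun h0 => ((h.isComponent i).mul_eq_zero_iff f).2 h0) fun h1 => h.ext fun j => ?_
    by_cases hj : j = i
    · subst hj; simp [h1]
    · simp [h.apply_of_ne i j hj]

/-- Every minimal idempotent is the indicator function of a single factor. -/
theorem exists_eq_of_isMinimalIdempotent (h : IsSubdirectProduct π e) {a : A}
    (ha : IsMinimalIdempotent a) : ∃ i, e i = a := by
  obtain ⟨haa, ha0, hmin⟩ := ha
  obtain ⟨i, hi⟩ : ∃ i, π i a ≠ 0 := by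
    by_contra! hall
    exact ha0 (h.eq_zero a hall)
  have hi1 : π i a = 1 := by
    have := congrArg (π i) haa
    rw [map_mul] at this
    exact (IsIdempotentElem.iff_eq_zero_or_one.1 this).resolve_left hi
  have hprod : a * e i = e i := h.ext fun j => by
    by_cases hj : j = i
    · subst hj; simp [hi1]
    · simp [h.apply_of_ne i j hj]
  rcases hmin (e i) (h.isMinimalIdempotent i).1 with h0 | h1
  · exact absurd (hprod.symm.trans h0) (h.isMinimalIdempotent i).2.1
  · exact ⟨i, hprod.symm.trans h1⟩

/-- A formula which implies being a minimal idempotent is satisfied by as many elements as there are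
factors whose indicator functions satisfy it. -/
theorem encard_definedSet (h : IsSubdirectProduct π e) (φ : FirstOrder.Language.ring.Formula ℕ) :
    (definedSet A (minimalIdempotentFormula ⊓ φ)).encard =
      {i | e i ∈ definedSet A (minimalIdempotentFormula ⊓ φ)}.encard := by
  rw [← h.injective.encard_image]
  congr 1
  ext a
  refine ⟨fun ha => ?_, ?_⟩
  · obtain ⟨i, rfl⟩ := h.exists_eq_of_isMinimalIdempotent (isMinimalIdempotent_of_mem_definedSet ha)
    exact ⟨i, ha, rfl⟩
  · rintro ⟨i, hi, rfl⟩
    exact hi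

end IsSubdirectProduct

end Product

section Adele

variable (K : Type*) [Field K] [NumberField K]

/-- The completion at a place, which is infinite or finite. -/
def PlaceCompletion : InfinitePlace K ⊕ HeightOneSpectrum (𝓞 K) → Type _
  | .inl v => v.Completion
  | .inr v => v.adicCompletion K

noncomputable instance : ∀ x, Field (PlaceCompletion K x)
  | .inl v => inferInstanceAs (Field v.Completion)
  | .inr v => inferInstanceAs (Field (v.adicCompletion K))

/-- The component of an adele at a place. -/
noncomputable def adeleEval : ∀ x, AdeleRing (𝓞 K) K →+* PlaceCompletion K x
  | .inl v => (Pi.evalRingHom (fun v : InfinitePlace K => v.Completion) v).comp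
      (RingHom.fst (InfiniteAdeleRing K) (FiniteAdeleRing (𝓞 K) K))
  | .inr v => (RestrictedProduct.evalRingHom (fun v : HeightOneSpectrum (𝓞 K) => v.adicCompletion K)
      (𝓕 := cofinite) (B := fun v => v.adicCompletionIntegers K) v).comp
      (RingHom.snd (InfiniteAdeleRing K) (FiniteAdeleRing (𝓞 K) K))

open Classical in
/-- The adele with a given component at one place and zero elsewhere. -/
noncomputable def adeleSingle : ∀ x, PlaceCompletion K x → AdeleRing (𝓞 K) K
  | .inl v, a => ((Pi.single v a : ∀ v : InfinitePlace K, v.Completion), 0)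
  | .inr v, a => (0, (RestrictedProduct.single (fun v : HeightOneSpectrum (𝓞 K) =>
      v.adicCompletionIntegers K) v a))

open Classical in
theorem adeleEval_adeleSingle_self (x) (a : PlaceCompletion K x) :
    adeleEval K x (adeleSingle K x a) = a := by
  rcases x with v | v
  · exact Pi.single_eq_same v a
  · exact RestrictedProduct.single_eq_same (fun v : HeightOneSpectrum (𝓞 K) =>
      v.adicCompletionIntegers K) v a

open Classical in
theorem adeleEval_adeleSingle_of_ne {x y} (h : y ≠ x) (a : PlaceCompletion K x) :
    adeleEval K y (adeleSingle K x a) = 0 := by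
  rcases x with v | v <;> rcases y with w | w
  · exact Pi.single_eq_of_ne (fun hw => h (congrArg _ hw)) a
  · rfl
  · rfl
  · exact RestrictedProduct.single_eq_of_ne (fun v : HeightOneSpectrum (𝓞 K) =>
      v.adicCompletionIntegers K) a (fun hw => h (congrArg _ hw))

theorem isSubdirectProduct_adeleRing :
    IsSubdirectProduct (adeleEval K) (fun x => adeleSingle K x 1) where
  eq_zero _ ha := Prod.ext (funext fun v => ha (.inl v))
    (FiniteAdeleRing.ext K fun v => ha (.inr v))
  surjective x a := ⟨_, adeleEval_adeleSingle_self K x a⟩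
  apply_self x := adeleEval_adeleSingle_self K x 1
  apply_of_ne _ _ h := adeleEval_adeleSingle_of_ne K h 1

end Adele

/-! ### Places determined by first-order sentences -/

section Archimedean

variable {K : Type*} [Field K]

theorem exists_pow_eq_completion (v : InfinitePlace K) {l : ℕ} (hl : Odd l) (x : v.Completion) :
    ∃ y, y ^ l = x := by
  have hl0 : l ≠ 0 := fun h => by simp [h] at hl
  rcases v.isReal_or_isComplex with hv | hv
  · let e := InfinitePlace.Completion.ringEquivRealOfIsReal hv
    obtain ⟨y, hy⟩ : ∃ y : ℝ, y ^ l = e x := by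
      rcases le_total 0 (e x) with h | h
      · exact ⟨_, Real.rpow_inv_natCast_pow h hl0⟩
      · refine ⟨-(-e x) ^ (l⁻¹ : ℝ), ?_⟩
        rw [hl.neg_pow, Real.rpow_inv_natCast_pow (neg_nonneg.2 h) hl0, neg_neg]
    exact ⟨e.symm y, e.injective (by simpa using hy)⟩
  · let e := InfinitePlace.Completion.ringEquivComplexOfIsComplex hv
    obtain ⟨y, hy⟩ := IsAlgClosed.exists_pow_nat_eq (e x) (Nat.pos_of_ne_zero hl0)
    exact ⟨e.symm y, e.injective (by simpa using hy)⟩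

theorem forall_exists_eq_sq_completion_iff (v : InfinitePlace K) :
    (∀ x : v.Completion, ∃ y : v.Completion, x = y ^ 2) ↔ v.IsComplex := by
  refine ⟨fun h => ?_, fun hv x => ?_⟩
  · by_contra hv
    let e := InfinitePlace.Completion.ringEquivRealOfIsReal
      (InfinitePlace.not_isComplex_iff_isReal.1 hv)
    obtain ⟨y, hy⟩ := h (-1)
    have := congrArg e hy
    rw [map_neg, map_one, map_pow] at this
    linarith [sq_nonneg (e y)]
  · let e := InfinitePlace.Completion.ringEquivComplexOfIsComplex hv
    obtain ⟨y, hy⟩ := IsAlgClosed.exists_pow_nat_eq (e x) two_pos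
    exact ⟨e.symm y, e.injective (by simpa using hy.symm)⟩

theorem exists_eq_sq_or_eq_neg_sq_completion (v : InfinitePlace K) (x : v.Completion) :
    ∃ y, x = y ^ 2 ∨ x = -y ^ 2 := by
  by_cases hv : v.IsComplex
  · obtain ⟨y, hy⟩ := (forall_exists_eq_sq_completion_iff v).2 hv x
    exact ⟨y, Or.inl hy⟩
  · let e := InfinitePlace.Completion.ringEquivRealOfIsReal
      (InfinitePlace.not_isComplex_iff_isReal.1 hv)
    refine ⟨e.symm √|e x|, ?_⟩
    have hsq : e (e.symm √|e x| ^ 2) = |e x| := by simp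
    refine (abs_choice (e x)).imp (fun h => e.injective ?_) fun h => e.injective ?_
    · rw [hsq, h]
    · rw [map_neg, hsq, h, neg_neg]

end Archimedean

section Counting

variable (K : Type*) [Field K] [NumberField K]

/-- The finite places of `K` over the rational prime `p`. -/
def placesAbove (p : ℕ) : Set (HeightOneSpectrum (𝓞 K)) := {v | (p : 𝓞 K) ∈ v.asIdeal}

/-- The polynomials with integer coefficients which have a root in `F`. -/
def polynomialsWithRoot (F : Type*) [Field F] : Set (Polynomial ℤ) :=
  {g | ∃ y : F, g.eval₂ (Int.castRingHom F) y = 0}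

theorem finite_placesAbove {p : ℕ} (hp : p ≠ 0) : (placesAbove K p).Finite := by
  have h : Ideal.span {(p : 𝓞 K)} ≠ 0 := by
    simpa [Ideal.span_singleton_eq_bot] using hp
  refine (Ideal.finite_factors h).subset fun v hv => ?_
  rw [Set.mem_ofPred_eq, Ideal.dvd_span_singleton]
  exact hv

theorem eventually_exp_neg_lt_valued {p : ℕ} (hp : p ≠ 0) :
    ∀ᶠ l : ℕ in atTop, ∀ v ∈ placesAbove K p,
      exp (-(l : ℤ)) < Valued.v (p : v.adicCompletion K) := by
  refine (eventually_all_finite (finite_placesAbove K hp)).2 fun v _ => ?_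
  have h0 : Valued.v (p : v.adicCompletion K) ≠ 0 :=
    (Valuation.ne_zero_iff _).2 (natCast_adicCompletion_ne_zero hp)
  filter_upwards [eventually_gt_atTop (-WithZero.log (Valued.v (p : v.adicCompletion K))).toNat]
    with l hl
  rw [← WithZero.exp_log h0, WithZero.exp_lt_exp]
  omega

variable {K}

theorem valued_natCast_eq_one_of_mem_placesAbove {p l : ℕ} (hp : p.Prime) (hl : l.Prime)
    (hlp : l ≠ p) {v : HeightOneSpectrum (𝓞 K)} (hv : v ∈ placesAbove K p) :
    Valued.v (l : v.adicCompletion K) = 1 := by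
  refine (valued_natCast_le_one l).eq_of_not_lt fun hlt => v.isPrime.ne_top ?_
  obtain ⟨a, b, hab⟩ := (Nat.isCoprime_iff_coprime.2 ((Nat.coprime_primes hl hp).2 hlp)).map
    (Int.castRingHom (𝓞 K))
  rw [map_natCast, map_natCast] at hab
  rw [Ideal.eq_top_iff_one, ← hab]
  exact v.asIdeal.add_mem (v.asIdeal.mul_mem_left _ ((valued_natCast_lt_one_iff l).1 hlt))
    (v.asIdeal.mul_mem_left _ hv)

/-- The formula `rootFormula p l g` counts the places above `p` whose completions contain a root
of `g`. Infinite places are excluded because the exponent `l` is odd, so that all elements of their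
completions are `l`-th powers. -/
theorem encard_definedSet_rootFormula {p l : ℕ} (hp : p.Prime) (hl : l.Prime) (hl2 : l ≠ 2)
    (hlp : l ≠ p)
    (hpl : ∀ v ∈ placesAbove K p, exp (-(l : ℤ)) < Valued.v (p : v.adicCompletion K))
    (g : Polynomial ℤ) :
    (definedSet (AdeleRing (𝓞 K) K) (rootFormula p l g)).encard =
      {v ∈ placesAbove K p | g ∈ polynomialsWithRoot (v.adicCompletion K)}.encard := by
  have hA := isSubdirectProduct_adeleRing K
  refine ((hA.encard_definedSet _).trans ?_).trans
    ((Sum.inr_injective (α := InfinitePlace K)).encard_image _)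
  refine congrArg Set.encard (Set.ext fun i => ?_)
  refine (mem_definedSet_rootFormula (hA.isComponent i) p l g).trans ?_
  rcases i with v | v
  · simp only [Set.mem_image, reduceCtorEq, and_false, exists_false, iff_false, not_and]
    intro _ h
    refine absurd h (not_residueCharProperty_of_forall_exists_pow_eq (F := v.Completion) ?_
      (exists_pow_eq_completion v (hl.odd_of_ne_two hl2)))
    intro h0
    have := congrArg (InfinitePlace.Completion.extensionEmbedding v) h0
    rw [map_natCast, map_zero] at this
    exact hp.ne_zero (Nat.cast_eq_zero.1 this)
  · rw [Sum.inr_injective.mem_set_image]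
    have hres : ResidueCharProperty (v.adicCompletion K) p l ↔ v ∈ placesAbove K p := by
      refine ⟨fun h => ?_, fun h => ?_⟩
      · by_contra hv
        refine not_residueCharProperty_of_valued_eq_one hl.ne_zero ?_ h
        exact (valued_natCast_le_one p).eq_of_not_lt
          fun hlt => hv ((valued_natCast_lt_one_iff p).1 hlt)
      · refine residueCharProperty_of_valued_lt_one hl ?_
          ((valued_natCast_lt_one_iff p).2 h) (hpl v h)
        exact valued_natCast_eq_one_of_mem_placesAbove hp hl hlp h
    exact ⟨fun ⟨_, h1, h2⟩ => ⟨hres.1 h1, h2⟩,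
      fun ⟨h1, h2⟩ => ⟨hA.isMinimalIdempotent _, hres.2 h1, h2⟩⟩

variable (K)

/-- A formula which fails at all finite places counts the infinite places at which it holds. -/
theorem encard_definedSet_eq_encard_infinitePlace {φ : FirstOrder.Language.ring.Formula ℕ}
    {P : InfinitePlace K → Prop}
    (hinl : ∀ v, adeleSingle K (.inl v) 1 ∈
      definedSet (AdeleRing (𝓞 K) K) (minimalIdempotentFormula ⊓ φ) ↔ P v)
    (hinr : ∀ v, adeleSingle K (.inr v) 1 ∉
      definedSet (AdeleRing (𝓞 K) K) (minimalIdempotentFormula ⊓ φ)) :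
    (definedSet (AdeleRing (𝓞 K) K) (minimalIdempotentFormula ⊓ φ)).encard =
      {v | P v}.encard := by
  refine (((isSubdirectProduct_adeleRing K).encard_definedSet _).trans ?_).trans
    ((Sum.inl_injective (β := HeightOneSpectrum (𝓞 K))).encard_image _)
  refine congrArg Set.encard (Set.ext fun i => ?_)
  rcases i with v | v
  · rw [Sum.inl_injective.mem_set_image]
    exact hinl v
  · simpa using hinr v

/-- Every element of `ℂ` is a square; this fails for `-1` in `ℝ`, and in the completions at finite
places a uniformizer is not a square. -/
theorem encard_definedSet_complexFormula :
    (definedSet (AdeleRing (𝓞 K) K) complexFormula).encard =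
      {v : InfinitePlace K | v.IsComplex}.encard := by
  have hA := isSubdirectProduct_adeleRing K
  refine encard_definedSet_eq_encard_infinitePlace K (fun v => ?_) fun v hv => ?_
  · refine (mem_definedSet_complexFormula (hA.isComponent (.inl v))).trans ?_
    exact (and_iff_right (hA.isMinimalIdempotent _)).trans (forall_exists_eq_sq_completion_iff v)
  · obtain ⟨x, hx⟩ := exists_ne_sq_and_ne_neg_sq v
    obtain ⟨y, hy⟩ := ((mem_definedSet_complexFormula (hA.isComponent (.inr v))).1 hv).2 x
    exact (hx y).1 hy

theorem encard_definedSet_realFormula :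
    (definedSet (AdeleRing (𝓞 K) K) realFormula).encard =
      {v : InfinitePlace K | v.IsReal}.encard := by
  have hA := isSubdirectProduct_adeleRing K
  refine encard_definedSet_eq_encard_infinitePlace K (fun v => ?_) fun v hv => ?_
  · refine (mem_definedSet_realFormula (hA.isComponent (.inl v))).trans ?_
    rw [← InfinitePlace.not_isComplex_iff_isReal, ← forall_exists_eq_sq_completion_iff v]
    exact (and_iff_right (hA.isMinimalIdempotent _)).trans
      (and_iff_right (exists_eq_sq_or_eq_neg_sq_completion v))
  · obtain ⟨x, hx⟩ := exists_ne_sq_and_ne_neg_sq v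
    obtain ⟨y, hy⟩ := ((mem_definedSet_realFormula (hA.isComponent (.inr v))).1 hv).2.1 x
    exact hy.elim (hx y).1 (hx y).2

/-- The prime exponent in the formulas for the places above `p` can be chosen to serve two number
fields at once. -/
theorem exists_auxiliary_prime (L : Type*) [Field L] [NumberField L] {p : ℕ} (hp : p.Prime) :
    ∃ l : ℕ, l.Prime ∧ l ≠ 2 ∧ l ≠ p ∧
      (∀ v ∈ placesAbove K p, exp (-(l : ℤ)) < Valued.v (p : v.adicCompletion K)) ∧
      ∀ w ∈ placesAbove L p, exp (-(l : ℤ)) < Valued.v (p : w.adicCompletion L) := by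
  obtain ⟨N, hN⟩ := eventually_atTop.1 ((eventually_ne_atTop 2).and ((eventually_ne_atTop p).and
    ((eventually_exp_neg_lt_valued K hp.ne_zero).and
      (eventually_exp_neg_lt_valued L hp.ne_zero))))
  obtain ⟨l, hNl, hl⟩ := Nat.exists_infinite_primes N
  exact ⟨l, hl, hN l hNl⟩

end Counting

/-! ### Matching the places above a prime number -/

section Matching

variable {K L : Type*} [Field K] [NumberField K] [Field L] [NumberField L]

theorem polynomialsWithRoot_subset_of_ringHom {F E : Type*} [Field F] [Field E] (φ : F →+* E) :
    polynomialsWithRoot F ⊆ polynomialsWithRoot E := by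
  rintro g ⟨y, hy⟩
  refine ⟨φ y, ?_⟩
  rw [← RingHom.ext_int (φ.comp (Int.castRingHom F)) (Int.castRingHom E), ← Polynomial.hom_eval₂,
    hy, map_zero]

/-- Having a root of the test polynomial of a place `t` above `p` is equivalent to having roots of
all the integral polynomials which have roots in the completion at `t`, by way of an embedding of
that completion. -/
theorem IsSeparatingGenerator.rootPolynomial_mem_iff {p l : ℕ} (hp : p.Prime) (hl : l.Prime)
    (hlp : l ≠ p) {t : HeightOneSpectrum (𝓞 K)} (ht : t ∈ placesAbove K p) {θ : 𝓞 K}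
    (hθ : IsSeparatingGenerator t p θ) {w : HeightOneSpectrum (𝓞 L)} (hw : w ∈ placesAbove L p)
    (hwl : exp (-(l : ℤ)) < Valued.v (p : w.adicCompletion L)) :
    rootPolynomial l θ ∈ polynomialsWithRoot (w.adicCompletion L) ↔
      polynomialsWithRoot (t.adicCompletion K) ⊆ polynomialsWithRoot (w.adicCompletion L) := by
  refine ⟨fun h => ?_, fun h => h (hθ.exists_aeval_eq_zero hl
    (valued_natCast_eq_one_of_mem_placesAbove hp hl hlp ht))⟩
  obtain ⟨φ, -⟩ := hθ.exists_isIntegralHom ((valued_natCast_lt_one_iff p).2 hw) hwl h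
  exact polynomialsWithRoot_subset_of_ringHom φ

/-- Completions above `p` with the same integral polynomials having roots are isomorphic. -/
theorem exists_ringEquiv_of_polynomialsWithRoot_eq {p : ℕ} (hp : p.Prime)
    {v : HeightOneSpectrum (𝓞 K)} (hv : v ∈ placesAbove K p)
    {w : HeightOneSpectrum (𝓞 L)} (hw : w ∈ placesAbove L p)
    (h : polynomialsWithRoot (w.adicCompletion L) = polynomialsWithRoot (v.adicCompletion K)) :
    ∃ e : v.adicCompletion K ≃+* w.adicCompletion L,
      Continuous e ∧ Continuous e.symm ∧ ∀ x, Valued.v (e x) ≤ 1 ↔ Valued.v x ≤ 1 := by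
  obtain ⟨l, hl, -, hlp, hK, hL⟩ := exists_auxiliary_prime K L hp
  obtain ⟨θ, hθ⟩ := exists_isSeparatingGenerator hp.ne_zero hv
  obtain ⟨η, hη⟩ := exists_isSeparatingGenerator hp.ne_zero hw
  obtain ⟨φ, hφ⟩ := hθ.exists_isIntegralHom ((valued_natCast_lt_one_iff p).2 hw) (hL w hw)
    ((hθ.rootPolynomial_mem_iff hp hl hlp hv hw (hL w hw)).2 h.ge)
  obtain ⟨ψ, hψ⟩ := hη.exists_isIntegralHom ((valued_natCast_lt_one_iff p).2 hv) (hK v hv)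
    ((hη.rootPolynomial_mem_iff hp hl hlp hw hv (hK v hv)).2 h.le)
  exact hφ.exists_ringEquiv hψ

theorem card_rootPolynomial_mem_eq (h : RingElementarilyEquivalent (AdeleRing (𝓞 K) K)
    (AdeleRing (𝓞 L) L)) {p l : ℕ} (hp : p.Prime) (hl : l.Prime) (hl2 : l ≠ 2) (hlp : l ≠ p)
    (hK : ∀ v ∈ placesAbove K p, exp (-(l : ℤ)) < Valued.v (p : v.adicCompletion K))
    (hL : ∀ w ∈ placesAbove L p, exp (-(l : ℤ)) < Valued.v (p : w.adicCompletion L))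
    (g : Polynomial ℤ) :
    Nat.card {v : placesAbove K p // g ∈ polynomialsWithRoot (v.1.adicCompletion K)} =
      Nat.card {w : placesAbove L p // g ∈ polynomialsWithRoot (w.1.adicCompletion L)} := by
  have key := congrArg ENat.toNat (((encard_definedSet_rootFormula hp hl hl2 hlp hK g).symm.trans
    (h.encard_definedSet_eq _)).trans (encard_definedSet_rootFormula hp hl hl2 hlp hL g))
  exact (Nat.card_congr (Equiv.subtypeSubtypeEquivSubtypeInter _ _)).trans (key.trans
    (Nat.card_congr (Equiv.subtypeSubtypeEquivSubtypeInter _ _)).symm)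

/-- Above each prime number, the places of the two fields can be matched so that their completions
are isomorphic. Completions are compared through the sets of integral polynomials with roots in them:
the number of sets containing a given one among them is expressed by a first-order formula. -/
theorem exists_equiv_placesAbove (h : RingElementarilyEquivalent (AdeleRing (𝓞 K) K)
    (AdeleRing (𝓞 L) L)) {p : ℕ} (hp : p.Prime) :
    ∃ σ : placesAbove K p ≃ placesAbove L p, ∀ v,
      ∃ e : v.1.adicCompletion K ≃+* (σ v).1.adicCompletion L,
        Continuous e ∧ Continuous e.symm ∧ ∀ x, Valued.v (e x) ≤ 1 ↔ Valued.v x ≤ 1 := by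
  obtain ⟨l, hl, hl2, hlp, hK, hL⟩ := exists_auxiliary_prime K L hp
  have := (finite_placesAbove K hp.ne_zero).to_subtype
  have := (finite_placesAbove L hp.ne_zero).to_subtype
  obtain ⟨σ, hσ⟩ := exists_equiv_of_card_le_eq
    (fun v : placesAbove K p => polynomialsWithRoot (v.1.adicCompletion K))
    (fun w : placesAbove L p => polynomialsWithRoot (w.1.adicCompletion L)) (by
      rintro _ (⟨t, rfl⟩ | ⟨t, rfl⟩)
      all_goals
        obtain ⟨θ, hθ⟩ := exists_isSeparatingGenerator hp.ne_zero t.2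
        refine (Nat.card_congr (Equiv.subtypeEquivRight fun v => ?_)).trans
          ((card_rootPolynomial_mem_eq h hp hl hl2 hlp hK hL (rootPolynomial l θ)).trans
            (Nat.card_congr (Equiv.subtypeEquivRight fun w => ?_)))
        · exact (hθ.rootPolynomial_mem_iff hp hl hlp t.2 v.2 (hK v v.2)).symm
        · exact hθ.rootPolynomial_mem_iff hp hl hlp t.2 w.2 (hL w w.2))
  exact ⟨σ, fun v => exists_ringEquiv_of_polynomialsWithRoot_eq hp v.2 (σ v).2 (hσ v)⟩

theorem eq_of_mem_placesAbove {p q : ℕ} (hp : p.Prime) (hq : q.Prime) {v : HeightOneSpectrum (𝓞 K)}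
    (hvp : v ∈ placesAbove K p) (hvq : v ∈ placesAbove K q) : p = q := by
  by_contra hne
  exact ((valued_natCast_lt_one_iff p).2 hvp).ne
    (valued_natCast_eq_one_of_mem_placesAbove hq hp hne hvq)

/-- The prime number below a finite place. -/
noncomputable def residuePrime (v : HeightOneSpectrum (𝓞 K)) : Nat.Primes :=
  ⟨(exists_prime_mem_asIdeal v).choose, (exists_prime_mem_asIdeal v).choose_spec.1⟩

theorem residuePrime_eq_iff (v : HeightOneSpectrum (𝓞 K)) (p : Nat.Primes) :
    residuePrime v = p ↔ v ∈ placesAbove K p := by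
  have hv : v ∈ placesAbove K (residuePrime v) := (exists_prime_mem_asIdeal v).choose_spec.2
  exact ⟨fun h => h ▸ hv, fun h => Subtype.ext (eq_of_mem_placesAbove (residuePrime v).2 p.2 hv h)⟩

theorem exists_equiv_heightOneSpectrum (h : RingElementarilyEquivalent (AdeleRing (𝓞 K) K)
    (AdeleRing (𝓞 L) L)) :
    ∃ σ : HeightOneSpectrum (𝓞 K) ≃ HeightOneSpectrum (𝓞 L), ∀ v,
      ∃ e : v.adicCompletion K ≃+* (σ v).adicCompletion L,
        Continuous e ∧ Continuous e.symm ∧ ∀ x, Valued.v (e x) ≤ 1 ↔ Valued.v x ≤ 1 := by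
  choose τ hτ using fun p : Nat.Primes => exists_equiv_placesAbove h p.2
  let fib (p : Nat.Primes) : {v : HeightOneSpectrum (𝓞 K) // residuePrime v = p} ≃
      {w : HeightOneSpectrum (𝓞 L) // residuePrime w = p} :=
    (Equiv.subtypeEquivRight fun v => residuePrime_eq_iff v p).trans
      ((τ p).trans (Equiv.subtypeEquivRight fun w => residuePrime_eq_iff w p).symm)
  exact ⟨(Equiv.sigmaFiberEquiv residuePrime).symm.trans
    ((Equiv.sigmaCongrRight fib).trans (Equiv.sigmaFiberEquiv residuePrime)),
    fun v => hτ (residuePrime v) ⟨v, (residuePrime_eq_iff v _).1 rfl⟩⟩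

end Matching

/-! ### Isomorphisms of adele rings from local isomorphisms -/

section Gluing

/-- Isomorphisms of topological rings between the factors, which match the distinguished subrings,
induce one between restricted products. -/
theorem exists_ringEquiv_restrictedProduct {I J : Type*} {R : I → Type*} {T : J → Type*}
    [∀ i, Ring (R i)] [∀ j, Ring (T j)] [∀ i, TopologicalSpace (R i)] [∀ j, TopologicalSpace (T j)]
    {S₁ S₂ : _ → Type*} [∀ i, SetLike (S₁ i) (R i)] [∀ j, SetLike (S₂ j) (T j)]
    [∀ i, SubringClass (S₁ i) (R i)] [∀ j, SubringClass (S₂ j) (T j)]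
    (B : ∀ i, S₁ i) (C : ∀ j, S₂ j) (σ : I ≃ J)
    (hσ : ∀ i, ∃ e : R i ≃+* T (σ i),
      Continuous e ∧ Continuous e.symm ∧ ∀ x, e x ∈ C (σ i) ↔ x ∈ B i) :
    ∃ φ : RestrictedProduct (fun i => R i) (fun i => (B i : Set (R i))) cofinite ≃+*
        RestrictedProduct (fun j => T j) (fun j => (C j : Set (T j))) cofinite,
      Continuous φ ∧ Continuous φ.symm := by
  -- Indexing the local isomorphisms by pairs of matched indices avoids transport along
  -- `σ (σ.symm j) = j`.
  have hE : ∀ i j, σ i = j → ∃ e : R i ≃+* T j,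
      Continuous e ∧ Continuous e.symm ∧ ∀ x, e x ∈ C j ↔ x ∈ B i := by
    rintro i _ rfl
    exact hσ i
  choose E hE₁ hE₂ hE₃ using hE
  have hF : ∀ᶠ j in cofinite, Set.MapsTo (E (σ.symm j) j (σ.apply_symm_apply j) : _ →+* _)
      (B (σ.symm j) : Set (R (σ.symm j))) (C j : Set (T j)) :=
    Eventually.of_forall fun j x hx => (hE₃ _ _ _ x).2 hx
  have hG : ∀ᶠ i in cofinite, Set.MapsTo ((E i (σ i) rfl).symm : _ →+* _)
      (C (σ i) : Set (T (σ i))) (B i : Set (R i)) :=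
    Eventually.of_forall fun i x hx => (hE₃ i _ rfl _).1 (by simpa using hx)
  let F := RestrictedProduct.mapAlongRingHom R T σ.symm σ.symm.injective.tendsto_cofinite
    (B₁ := B) (B₂ := C) _ hF
  let G := RestrictedProduct.mapAlongRingHom T R σ σ.injective.tendsto_cofinite
    (B₁ := C) (B₂ := B) _ hG
  have hGF : G.comp F = RingHom.id _ := by
    refine RingHom.ext fun x => RestrictedProduct.ext _ _ fun i => ?_
    have key : ∀ i' (h : σ i' = σ i), (E i (σ i) rfl).symm (E i' (σ i) h (x i')) = x i := by
      intro i' h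
      obtain rfl := σ.injective h
      exact RingEquiv.symm_apply_apply _ _
    exact key _ (σ.apply_symm_apply (σ i))
  have hFG : F.comp G = RingHom.id _ := by
    refine RingHom.ext fun x => RestrictedProduct.ext _ _ fun j => ?_
    have key : ∀ i j (h : σ i = j), E i j h ((E i (σ i) rfl).symm (x (σ i))) = x j := by
      rintro i _ rfl
      exact RingEquiv.apply_symm_apply _ _
    exact key _ _ (σ.apply_symm_apply j)
  exact ⟨RingEquiv.ofRingHom F G hFG hGF,
    RestrictedProduct.mapAlong_continuous _ _ _ σ.symm.injective.tendsto_cofinite _ hF fun j => hE₁ _ _ _,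
    RestrictedProduct.mapAlong_continuous _ _ _ σ.injective.tendsto_cofinite _ hG fun i => hE₂ _ _ _⟩

theorem exists_ringEquiv_completion {K L : Type*} [Field K] [Field L]
    {v : InfinitePlace K} {w : InfinitePlace L}
    (h : v.IsComplex ↔ w.IsComplex) :
    ∃ e : v.Completion ≃+* w.Completion, Continuous e ∧ Continuous e.symm := by
  by_cases hv : v.IsComplex
  · have hw := h.1 hv
    let a := InfinitePlace.Completion.isometryEquivComplexOfIsComplex hv
    let b := InfinitePlace.Completion.isometryEquivComplexOfIsComplex hw
    exact ⟨(InfinitePlace.Completion.ringEquivComplexOfIsComplex hv).trans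
      (InfinitePlace.Completion.ringEquivComplexOfIsComplex hw).symm,
      b.symm.continuous.comp a.continuous, a.symm.continuous.comp b.continuous⟩
  · have hv' := InfinitePlace.not_isComplex_iff_isReal.1 hv
    have hw' := InfinitePlace.not_isComplex_iff_isReal.1 (mt h.2 hv)
    let a := InfinitePlace.Completion.isometryEquivRealOfIsReal hv'
    let b := InfinitePlace.Completion.isometryEquivRealOfIsReal hw'
    exact ⟨(InfinitePlace.Completion.ringEquivRealOfIsReal hv').trans
      (InfinitePlace.Completion.ringEquivRealOfIsReal hw').symm,
      b.symm.continuous.comp a.continuous, a.symm.continuous.comp b.continuous⟩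

variable {K L : Type*} [Field K] [NumberField K] [Field L] [NumberField L]

theorem exists_ringEquiv_finiteAdeleRing (h : RingElementarilyEquivalent (AdeleRing (𝓞 K) K)
    (AdeleRing (𝓞 L) L)) :
    ∃ φ : FiniteAdeleRing (𝓞 K) K ≃+* FiniteAdeleRing (𝓞 L) L,
      Continuous φ ∧ Continuous φ.symm := by
  obtain ⟨σ, hσ⟩ := exists_equiv_heightOneSpectrum h
  exact exists_ringEquiv_restrictedProduct
    (fun v : HeightOneSpectrum (𝓞 K) => v.adicCompletionIntegers K)
    (fun w : HeightOneSpectrum (𝓞 L) => w.adicCompletionIntegers L) σ hσ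

theorem exists_equiv_infinitePlace (h : RingElementarilyEquivalent (AdeleRing (𝓞 K) K)
    (AdeleRing (𝓞 L) L)) :
    ∃ σ : InfinitePlace K ≃ InfinitePlace L, ∀ v, v.IsComplex ↔ (σ v).IsComplex := by
  have hc : Nat.card {v : InfinitePlace K // v.IsComplex} =
      Nat.card {w : InfinitePlace L // w.IsComplex} :=
    congrArg ENat.toNat (((encard_definedSet_complexFormula K).symm.trans
      (h.encard_definedSet_eq _)).trans (encard_definedSet_complexFormula L))
  have hr : Nat.card {v : InfinitePlace K // v.IsReal} =
      Nat.card {w : InfinitePlace L // w.IsReal} :=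
    congrArg ENat.toNat (((encard_definedSet_realFormula K).symm.trans
      (h.encard_definedSet_eq _)).trans (encard_definedSet_realFormula L))
  simp only [← InfinitePlace.not_isComplex_iff_isReal] at hr
  obtain ⟨c⟩ := Finite.card_eq.1 hc
  obtain ⟨r⟩ := Finite.card_eq.1 hr
  classical
  refine ⟨(Equiv.sumCompl fun v : InfinitePlace K => v.IsComplex).symm.trans
    ((Equiv.sumCongr c r).trans (Equiv.sumCompl fun w : InfinitePlace L => w.IsComplex)),
    fun v => ?_⟩
  by_cases hv : v.IsComplex
  · simpa [hv, Equiv.sumCompl_symm_apply_of_pos] using (c ⟨v, hv⟩).2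
  · simpa [hv, Equiv.sumCompl_symm_apply_of_neg] using (r ⟨v, hv⟩).2

theorem exists_ringEquiv_infiniteAdeleRing (h : RingElementarilyEquivalent (AdeleRing (𝓞 K) K)
    (AdeleRing (𝓞 L) L)) :
    ∃ φ : InfiniteAdeleRing K ≃+* InfiniteAdeleRing L, Continuous φ ∧ Continuous φ.symm := by
  obtain ⟨σ, hσ⟩ := exists_equiv_infinitePlace h
  choose E hE₁ hE₂ using fun v => exists_ringEquiv_completion (hσ v)
  let Φ : (∀ v : InfinitePlace K, v.Completion) ≃ₜ ∀ w : InfinitePlace L, w.Completion :=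
    Homeomorph.piCongr σ fun v => ⟨(E v).toEquiv, hE₁ v, hE₂ v⟩
  exact ⟨(RingEquiv.piCongrRight E).trans (RingEquiv.piCongrLeft _ σ), Φ.continuous,
    Φ.symm.continuous⟩

end Gluing

theorem mainTheorem1 (K L : Type*) [Field K] [NumberField K] [Field L] [NumberField L]
    (h : RingElementarilyEquivalent
      (NumberField.AdeleRing (𝓞 K) K) (NumberField.AdeleRing (𝓞 L) L)) :
    ∃ φ : NumberField.AdeleRing (𝓞 K) K ≃+* NumberField.AdeleRing (𝓞 L) L,
      Continuous φ ∧ Continuous φ.symm := by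
  obtain ⟨φ, hφ, hφ'⟩ := exists_ringEquiv_infiniteAdeleRing h
  obtain ⟨ψ, hψ, hψ'⟩ := exists_ringEquiv_finiteAdeleRing h
  exact ⟨RingEquiv.prodCongr φ ψ, hφ.prodMap hψ, hφ'.prodMap hψ'⟩
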